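/- Let $G=(V,E)$ be a finite undirected, connected, chordal graph (UCCG), and let $\Pi(G)$ be the set of its maximal cliques. Consider the following recursive procedure count, called on $G$ with an empty memo table. We use these notions, for a graph $H$ with vertex set $V_H$. - An acyclic moral orientation (AMO) of $H$ directs every edge of $H$ so that there is no directed cycle and no induced $a\to b\leftarrow c$ (with $a\neq c$ nonadjacent). A linear ordering of $V_H$ represents an AMO if $u$ precedes $v$ for every edge $u\to v$. - For a clique $K$ of $H$, $H^K$ is the union of all AMOs of $H$ that are represented by some linear ordering of $V_H$ beginning with the vertices of $K$ in some order; $\mathcal C_H(K)$ is the set of undirected connected components of $H^K[V_H\setminus K]$, i.e. the connected components of the graph on $V_H\setminus K$ whose edges are those that occur in both directions in $H^K$. - A rooted clique tree $\mathcal T=(T,r,\iota)$ of $H$ is a rooted tree $(T,r)$ with a bijection $\iota$ from its nodes to $\Pi(H)$ such that for each $v\in V_H$ the nodes $x$ with $v\in\iota(x)$ induce a connected subtree. For a node $x$ with root path $r=x_1,\dots,x_p=x$, $\mathrm{FP}(x,\mathcal T)$ is the set of all $\iota(x_i)\cap\iota(x_{i+1})$, $1\le i<p$, that are contained in $\iota(x)$.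 - $\phi(S,R)$ is the number of permutations of $S$ that have no set in $R$ as a prefix. The call count$(H,\mathrm{memo})$ returns $\mathrm{memo}[H]$ if this value is already stored. Otherwise it picks a rooted clique tree $\mathcal T=(T,r,\iota)$ of $H$, traverses $T$ from the root by breadth-first search with a queue, for each node $x$ calls count$(C,\mathrm{memo})$ on every $C\in\mathcal C_H(\iota(x))$, in any order, and multiplies the results to obtain $p_x$, and finally stores in $\mathrm{memo}[H]$ and returns $\sum_x \phi(\iota(x),\mathrm{FP}(x,\mathcal T))\cdot p_x$. **Proposition.** The procedure count, started on a UCCG $G$, has a complete (terminating) execution, and in every complete execution, whatever rooted clique trees and enumeration orders are chosen, all graphs on which count is called (including $G$ itself) are UCCGs, and the number of distinct ones among them is at most $$2\,|\Pi(G)|-1 .$$ -/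

import Mathlib

/-- `τ` is a linear ordering (a permutation) of the set `S`: it lists every element of `S` exactly
once, and nothing else. -/
def IsOrderingOf {V : Type*} (S : Set V) (τ : List V) : Prop :=
  τ.Nodup ∧ ∀ v, v ∈ τ ↔ v ∈ S

/-- A graph is chordal if no set of four or more vertices induces a cycle. -/
def IsChordalGraph {W : Type*} (G : SimpleGraph W) : Prop :=
  ∀ n : ℕ, 4 ≤ n → IsEmpty (SimpleGraph.cycleGraph n ↪g G)

/-- Undirected connected chordal graph. -/
def IsUCCG {W : Type*} (G : SimpleGraph W) : Prop :=
  G.Connected ∧ IsChordalGraph G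

namespace CliquePicking

/-! All graphs which the procedure handles live inside a fixed graph `G` on `V`: a graph `H` is a
subgraph of `G`, with its own vertex set `H.verts` and its own adjacency `H.Adj`; the graph `G`
itself is `⊤`. -/

variable {V : Type*} {G : SimpleGraph V}

/-- The set `Π(H)` of all maximal cliques of `H`. -/
def maxCliques (H : G.Subgraph) : Set (Set V) :=
  {K | Maximal (fun C : Set V => C ⊆ H.verts ∧ C.Pairwise H.Adj) K}

/-- The directed graph with edge relation `A` is an orientation of `H`: each edge of `H` is
replaced by exactly one of its two directions. -/
def IsOrientation (H : G.Subgraph) (A : V → V → Prop) : Prop :=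
  (∀ u v, H.Adj u v ↔ A u v ∨ A v u) ∧ ∀ u v, A u v → ¬ A v u

/-- `A` is an acyclic moral orientation (AMO) of `H`: it has no directed cycle and no
v-structure, that is, no `a → b ← c` with `a`, `c` distinct and nonadjacent. -/
structure IsAMO (H : G.Subgraph) (A : V → V → Prop) : Prop where
  orientation : IsOrientation H A
  acyclic : ∀ v, ¬ Relation.TransGen A v v
  moral : ∀ a b c, A a b → A c b → a ≠ c → H.Adj a c

/-- `τ` is a topological ordering of the vertices of `H` that represents the orientation `A`:
`u` precedes `v` in `τ` for every edge `u → v`. -/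
def Represents (H : G.Subgraph) (τ : List V) (A : V → V → Prop) : Prop :=
  IsOrderingOf H.verts τ ∧ ∀ u v, A u v → [u, v].Sublist τ

/-- The edge relation of the `π(K)`-orientation of `H`: the union of all AMOs of `H` that can be
represented by a topological ordering beginning with `π`. -/
def permOrientation (H : G.Subgraph) (π : List V) (u v : V) : Prop :=
  ∃ A : V → V → Prop, IsAMO H A ∧ (∃ τ, Represents H τ A ∧ π <+: τ) ∧ A u v

/-- The edge relation of `H^K`, the union of the `π(K)`-orientations of `H` over all permutations
`π` of `K`. -/
def cliqueOrientation (H : G.Subgraph) (K : Set V) (u v : V) : Prop :=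
  ∃ π, IsOrderingOf K π ∧ permOrientation H π u v

theorem cliqueOrientation_adj {H : G.Subgraph} {K : Set V} {u v : V}
    (h : cliqueOrientation H K u v) : H.Adj u v := by
  obtain ⟨π, -, A, hA, -, huv⟩ := h
  exact (hA.orientation.1 u v).2 (Or.inl huv)

/-- The undirected part of `H^K[V_H ∖ K]`: all vertices of `V_H ∖ K`, and those edges between
them which occur in both directions in `H^K`. -/
def undirectedPart (H : G.Subgraph) (K : Set V) : G.Subgraph where
  verts := H.verts \ K
  Adj u v := (u ∉ K ∧ v ∉ K) ∧ cliqueOrientation H K u v ∧ cliqueOrientation H K v u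
  adj_sub h := H.adj_sub (cliqueOrientation_adj h.2.1)
  edge_vert h := ⟨H.edge_vert (cliqueOrientation_adj h.2.1), h.1.1⟩
  symm := ⟨fun _ _ h => ⟨⟨h.1.2, h.1.1⟩, h.2.2, h.2.1⟩⟩

/-- `𝒞_H(K)`: the undirected connected components of `H^K[V_H ∖ K]`, that is, the maximal
connected subgraphs of its undirected part. -/
def components (H : G.Subgraph) (K : Set V) : Set G.Subgraph :=
  {C | Maximal (fun D : G.Subgraph => D ≤ undirectedPart H K ∧ D.Connected) C}

/-- `φ(S, R)`: the number of permutations of `S` that do not have a set `S' ∈ R` as prefix. -/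
noncomputable def phi (S : Set V) (R : Set (Set V)) : ℕ :=
  {π : List V | IsOrderingOf S π ∧ ∀ ρ : List V, ρ <+: π → {v | v ∈ ρ} ∉ R}.ncard

/-- A rooted clique tree of `H`. The nodes of the tree are taken to be the maximal cliques of `H`
themselves, so that the bijection between nodes and maximal cliques is the identity. -/
structure RootedCliqueTree (H : G.Subgraph) where
  /-- the underlying tree -/
  tree : SimpleGraph (maxCliques H)
  isTree : tree.IsTree
  /-- the root -/
  root : maxCliques H
  connected : ∀ v ∈ H.verts, (tree.induce {K : maxCliques H | v ∈ K.1}).Connected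

/-- The children of a node: its neighbours that are farther away from the root. -/
def RootedCliqueTree.children {H : G.Subgraph} (T : RootedCliqueTree H) (x : maxCliques H) :
    Set (maxCliques H) :=
  {y | T.tree.Adj x y ∧ T.tree.dist T.root y = T.tree.dist T.root x + 1}

/-- The set `FP(x, T)` of forbidden prefixes of a node `x`: the intersections of consecutive
cliques on the path from the root to `x` that are contained in `x`. -/
def RootedCliqueTree.forbiddenPrefixes {H : G.Subgraph} (T : RootedCliqueTree H)
    (x : maxCliques H) : Set (Set V) :=
  {S | S ⊆ x.1 ∧ ∃ p : T.tree.Walk T.root x, p.IsPath ∧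
    ∃ d ∈ p.darts, S = d.fst.1 ∩ d.snd.1}

/-- The memo table: the partial map from graphs to already computed values. -/
abbrev Memo (G : SimpleGraph V) : Type _ := G.Subgraph → Option ℕ

open Classical in
/-- The table after the assignment `memo[H] = n`. -/
noncomputable def Memo.store (memo : Memo G) (H : G.Subgraph) (n : ℕ) : Memo G :=
  Function.update memo H (some n)

mutual

/-- Execution of the recursive procedure `count(H, memo)`. `CountRun memo H calls n memo'` says
that `count(H, memo)` has a complete execution which returns `n` and leaves the table in state
`memo'`, and in the course of which `count` is called exactly on the graphs in the list `calls`
(this call on `H` included, in chronological order). The choice of the rooted clique tree and the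
orders in which children and components are enumerated are left open, as in the pseudocode. -/
inductive CountRun : Memo G → G.Subgraph → List G.Subgraph → ℕ → Memo G → Prop
  /-- `if H ∈ memo then return memo[H]` -/
  | hit {memo : Memo G} {H : G.Subgraph} {n : ℕ} (h : memo H = some n) :
      CountRun memo H [H] n memo
  /-- otherwise pick a rooted clique tree, put its root into the queue, run the while loop starting
  with `sum = 0`, store and return the sum -/
  | miss {memo memo' : Memo G} {H : G.Subgraph} {calls : List G.Subgraph} {sum : ℕ}
      (h : memo H = none) (T : RootedCliqueTree H)
      (run : QueueRun H T memo [T.root] 0 calls sum memo') :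
      CountRun memo H (H :: calls) sum (memo'.store H sum)

/-- Execution of the while loop of `count` on `H` with clique tree `T`:
`QueueRun H T memo Q sum calls sum' memo'` says that the loop, entered with table `memo`, queue `Q`
and accumulator `sum`, ends with accumulator `sum'` and table `memo'`, calling `count` on
`calls`. -/
inductive QueueRun : (H : G.Subgraph) → RootedCliqueTree H → Memo G → List (maxCliques H) →
    ℕ → List G.Subgraph → ℕ → Memo G → Prop
  /-- the queue is empty -/
  | done {H : G.Subgraph} {T : RootedCliqueTree H} {memo : Memo G} {sum : ℕ} :
      QueueRun H T memo [] sum [] sum memo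
  /-- pop `x`, push the children of `x`, multiply the counts of all components in `𝒞_H(x)`, and add
  the product, weighted by `φ(x, FP(x, T))`, to the accumulator -/
  | pop {H : G.Subgraph} {T : RootedCliqueTree H} {memo memo₁ memo₂ : Memo G} {x : maxCliques H}
      {Q ch : List (maxCliques H)} {comps calls₁ calls₂ : List G.Subgraph} {sum prod sum' : ℕ}
      (hch : IsOrderingOf (T.children x) ch)
      (hcomps : IsOrderingOf (components H x.1) comps)
      (run₁ : ProdRun memo comps 1 calls₁ prod memo₁)
      (run₂ : QueueRun H T memo₁ (Q ++ ch) (sum + phi x.1 (T.forbiddenPrefixes x) * prod)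
        calls₂ sum' memo₂) :
      QueueRun H T memo (x :: Q) sum (calls₁ ++ calls₂) sum' memo₂

/-- Execution of the for-each loop: `ProdRun memo comps prod calls prod' memo'` says that the loop
over the graphs in `comps`, entered with table `memo` and accumulator `prod`, ends with accumulator
`prod'` and table `memo'`, calling `count` on `calls`. -/
inductive ProdRun : Memo G → List G.Subgraph → ℕ → List G.Subgraph → ℕ → Memo G → Prop
  | nil {memo : Memo G} {prod : ℕ} : ProdRun memo [] prod [] prod memo
  | cons {memo memo₁ memo₂ : Memo G} {C : G.Subgraph} {comps calls₁ calls₂ : List G.Subgraph}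
      {prod n prod' : ℕ}
      (run₁ : CountRun memo C calls₁ n memo₁)
      (run₂ : ProdRun memo₁ comps (prod * n) calls₂ prod' memo₂) :
      ProdRun memo (C :: comps) prod (calls₁ ++ calls₂) prod' memo₂

end

/-- `IsExecution G calls n`: the call `count(G, ∅)`, started with the empty table, has a complete
execution that returns `n` and calls `count` exactly on the graphs in the list `calls`. -/
def IsExecution (G : SimpleGraph V) (calls : List G.Subgraph) (n : ℕ) : Prop :=
  ∃ memo' : Memo G, CountRun (fun _ => none) ⊤ calls n memo'

end CliquePicking

-- Take a nonempty clique S whose common neighbourhood is disconnected; the components of that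
-- neighbourhood are called petals. Every graph on which `count` is called is G or is induced by a
-- petal of G (`CountRun.isExplorable`). A chordal graph with m maximal cliques has at most 2(m - 1)
-- petals (`ncard_petals_le`). Adding G itself gives 2m - 1.
--
-- Why 𝒞_H(K) consists of petals: let D be a component of H - K. Its outer boundary is a clique;
-- call the vertices of D adjacent to the whole boundary inner. An edge between inner vertices
-- occurs in both directions, since some perfect ordering that begins with K visits either end first
-- (`Region.exists_isPerfect`). By morality no arc leaves D, nor a component of D minus its inner
-- vertices (`Region.not_arc`). Recursing on those components reaches every vertex outside K, so
-- each member of 𝒞_H(K) is induced by a component of an inner set. This is also a component of the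
-- common neighbourhood of the boundary (`compIn_inner_eq`), and maximality of K supplies a common
-- neighbour elsewhere. A petal of a petal of G is a petal of G (`IsPetal.trans`), so the recursion
-- creates nothing new.
--
-- Why petals are few: fix a rooted clique tree and label each non-root node with its intersection
-- with its parent. For a clique S, a component of its common neighbourhood that misses a clique
-- containing S nearest to the root meets a node labelled S (`exists_label_eq`). As a petal is never
-- the only component, S is always a label, and each non-root node accounts for at most two petals:
-- one meeting that node, one meeting the top clique of its label.
--
-- Complete executions exist because chordal graphs have clique trees and every recursive call is on
-- fewer vertices.

namespace CliquePicking

-- Connected sets, their boundaries and cliques in chordal graphs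

section ChordalGraphs

variable {V : Type*} {Γ : SimpleGraph V}

theorem cycleGraph_adj_of_lt {N : ℕ} {a b : Fin N} (h : a < b) :
    (SimpleGraph.cycleGraph N).Adj a b ↔ b.val = a.val + 1 ∨ (a.val = 0 ∧ b.val + 1 = N) := by
  rw [SimpleGraph.cycleGraph_adj']
  have h' : a.val < b.val := h
  have hb := b.isLt
  have h1 : (a - b).val = N - b.val + a.val := by
    rw [Fin.sub_def]
    exact Nat.mod_eq_of_lt (by omega)
  have h2 : (b - a).val = b.val - a.val := Fin.sub_val_of_le h.le
  omega

/-- A chordless path from `p 0` to `p n`, closed up by a vertex `s` which is adjacent to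
both of its ends and to nothing else on it. -/
theorem not_isChordalGraph_of_path {p : ℕ → V} {s : V} {n : ℕ} (hn : 2 ≤ n)
    (hinj : ∀ i j, i < j → j ≤ n → p i ≠ p j)
    (hadj : ∀ i j, i < j → j ≤ n → (Γ.Adj (p i) (p j) ↔ j = i + 1))
    (hs : ∀ i, i ≤ n → (Γ.Adj (p i) s ↔ i = 0 ∨ i = n)) (hne : ∀ i, i ≤ n → p i ≠ s) :
    ¬ IsChordalGraph Γ := by
  intro hc
  let f : Fin (n + 2) → V := fun i => if i.val ≤ n then p i.val else s
  have hlt : ∀ a b : Fin (n + 2), a < b → f a ≠ f b ∧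
      (Γ.Adj (f a) (f b) ↔ (SimpleGraph.cycleGraph (n + 2)).Adj a b) := by
    intro a b hab
    rw [cycleGraph_adj_of_lt hab]
    have h' : a.val < b.val := hab
    have hb := b.isLt
    have ha : a.val ≤ n := by omega
    by_cases hbn : b.val ≤ n
    · simp only [f, ha, hbn, if_true]
      refine ⟨hinj _ _ h' hbn, ?_⟩
      rw [hadj _ _ h' hbn]
      omega
    · simp only [f, ha, hbn, if_true, if_false]
      refine ⟨hne _ ha, ?_⟩
      rw [hs _ ha]
      omega
  have hinj' : Function.Injective f := by
    intro a b hab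
    rcases lt_trichotomy a b with h | h | h
    · exact absurd hab (hlt _ _ h).1
    · exact h
    · exact absurd hab.symm (hlt _ _ h).1
  refine (hc (n + 2) (by omega)).false ⟨⟨f, hinj'⟩, ?_⟩
  intro a b
  simp only [Function.Embedding.coeFn_mk]
  rcases lt_trichotomy a b with h | h | h
  · exact (hlt _ _ h).2
  · subst h; simp
  · rw [Γ.adj_comm, SimpleGraph.adj_comm _ a b]
    exact (hlt _ _ h).2

/-- `y` can be reached from `x` by a path of `Γ` inside the set `D`. -/
def ReachIn (Γ : SimpleGraph V) (D : Set V) : V → V → Prop :=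
  Relation.ReflTransGen fun a b => Γ.Adj a b ∧ a ∈ D ∧ b ∈ D

/-- The subgraph of `Γ` induced by `D` has at most one connected component. -/
def ConnSet (Γ : SimpleGraph V) (D : Set V) : Prop :=
  ∀ x ∈ D, ∀ y ∈ D, ReachIn Γ D x y

/-- The vertices which can be reached from `v` inside `D`. -/
def compIn (Γ : SimpleGraph V) (D : Set V) (v : V) : Set V := {z | ReachIn Γ D v z}

/-- The vertices outside of `D` with a neighbour in `D`. -/
def nb (Γ : SimpleGraph V) (D : Set V) : Set V := {b | b ∉ D ∧ ∃ d ∈ D, Γ.Adj d b}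

/-- The common neighbours of `S`. -/
def commonNb (Γ : SimpleGraph V) (S : Set V) : Set V := {v | ∀ s ∈ S, Γ.Adj s v}

theorem ReachIn.symm {D : Set V} {x y : V} (h : ReachIn Γ D x y) : ReachIn Γ D y x := by
  induction h with
  | refl => exact .refl
  | tail _ h ih => exact .head ⟨h.1.symm, h.2.2, h.2.1⟩ ih

theorem ReachIn.mono {D E : Set V} (hDE : D ⊆ E) {x y : V} (h : ReachIn Γ D x y) :
    ReachIn Γ E x y :=
  Relation.ReflTransGen.mono (fun _ _ h => ⟨h.1, hDE h.2.1, hDE h.2.2⟩) _ _ h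

theorem ReachIn.mem {D : Set V} {x y : V} (hx : x ∈ D) (h : ReachIn Γ D x y) : y ∈ D := by
  cases h with
  | refl => exact hx
  | tail _ h => exact h.2.2

/-- A path inside `D` from a vertex in `Q` to a vertex outside of `Q` leaves `Q` somewhere. -/
theorem ReachIn.exists_exit {D : Set V} (Q : Set V) {x y : V} (h : ReachIn Γ D x y) (hx : x ∈ Q)
    (hy : y ∉ Q) : ∃ a b, a ∈ Q ∧ b ∉ Q ∧ a ∈ D ∧ b ∈ D ∧ Γ.Adj a b := by
  induction h with
  | refl => exact absurd hx hy
  | @tail b c _ h ih =>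
    by_cases hb : b ∈ Q
    · exact ⟨b, c, hb, hy, h.2.1, h.2.2, h.1⟩
    · exact ih hb

theorem mem_compIn_self {D : Set V} {v : V} : v ∈ compIn Γ D v := Relation.ReflTransGen.refl

theorem compIn_subset {D : Set V} {v : V} (hv : v ∈ D) : compIn Γ D v ⊆ D :=
  fun _ h => ReachIn.mem hv h

theorem mem_compIn_of_adj {D : Set V} {v a b : V} (hv : v ∈ D) (ha : a ∈ compIn Γ D v)
    (hb : b ∈ D) (h : Γ.Adj a b) : b ∈ compIn Γ D v :=
  Relation.ReflTransGen.tail ha ⟨h, compIn_subset hv ha, hb⟩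

theorem ReachIn.compIn {D : Set V} {v z : V} (hv : v ∈ D) (h : ReachIn Γ D v z) :
    ReachIn Γ (compIn Γ D v) v z := by
  induction h with
  | refl => exact .refl
  | tail h' h ih =>
    exact .tail ih ⟨h.1, h', mem_compIn_of_adj hv h' h.2.2 h.1⟩

theorem connSet_compIn {D : Set V} {v : V} (hv : v ∈ D) : ConnSet Γ (compIn Γ D v) :=
  fun _ hx _ hy => (ReachIn.compIn hv hx).symm.trans (ReachIn.compIn hv hy)

theorem not_mem_of_mem_nb_compIn {D : Set V} {v b : V} (hv : v ∈ D)
    (hb : b ∈ nb Γ (compIn Γ D v)) : b ∉ D := by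
  obtain ⟨h, d, hd, hdb⟩ := hb
  exact fun hbD => h (mem_compIn_of_adj hv hd hbD hdb)

theorem ConnSet.subset_compIn {D E : Set V} (hE : ConnSet Γ E) (hED : E ⊆ D) {v x : V}
    (hx : x ∈ E) (hvx : x ∈ compIn Γ D v) : E ⊆ compIn Γ D v :=
  fun y hy => Relation.ReflTransGen.trans hvx ((hE x hx y hy).mono hED)

theorem connSet_insert {D : Set V} (hD : ConnSet Γ D) {v d : V} (hd : d ∈ D) (h : Γ.Adj d v) :
    ConnSet Γ (insert v D) := by
  have key : ∀ x ∈ insert v D, ReachIn Γ (insert v D) d x := by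
    rintro x (rfl | hx)
    · exact .single ⟨h, Set.mem_insert_of_mem _ hd, Set.mem_insert _ _⟩
    · exact (hD d hd x hx).mono (Set.subset_insert _ _)
  exact fun x hx y hy => (key x hx).symm.trans (key y hy)

theorem compIn_eq_of_mem {D : Set V} {v w : V} (h : w ∈ compIn Γ D v) :
    compIn Γ D w = compIn Γ D v := by
  ext z
  exact ⟨fun hz => Relation.ReflTransGen.trans h hz,
    fun hz => Relation.ReflTransGen.trans (ReachIn.symm h) hz⟩

/-- In a chordal graph, the common neighbours of a vertex `s` and of a connected set which avoids
`s` and its neighbours form a clique. -/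
theorem adj_of_connSet (hΓ : IsChordalGraph Γ) {R : Set V} (hR : ConnSet Γ R) {s x y : V}
    (hRs : ∀ r ∈ R, ¬ Γ.Adj s r) (hsR : s ∉ R) (hsx : Γ.Adj s x) (hsy : Γ.Adj s y)
    (hxR : ∃ r ∈ R, Γ.Adj x r) (hyR : ∃ r ∈ R, Γ.Adj y r) (hxy : x ≠ y) : Γ.Adj x y := by
  by_contra hnadj
  obtain ⟨r, hr, hxr⟩ := hxR
  obtain ⟨r', hr', hyr⟩ := hyR
  let Z : Set V := insert x (insert y R)
  -- A shortest path from `x` to `y` in Γ[Z] is chordless, since an edge changes the distance from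
  -- `x` by at most one. Only its ends see `s`, so `s` closes it to an induced cycle of length at
  -- least four.
  let Δ : SimpleGraph V :=
    { Adj := fun a b => Γ.Adj a b ∧ a ∈ Z ∧ b ∈ Z
      symm := ⟨fun a b h => ⟨h.1.symm, h.2.2, h.2.1⟩⟩
      loopless := ⟨fun a h => h.1.ne rfl⟩ }
  have hRZ : ∀ a ∈ R, a ∈ Z := fun a ha => Or.inr (Or.inr ha)
  have hxZ : x ∈ Z := Or.inl rfl
  have hyZ : y ∈ Z := Or.inr (Or.inl rfl)
  have hreach : Δ.Reachable x y := by
    rw [SimpleGraph.reachable_iff_reflTransGen]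
    refine .head (b := r) ⟨hxr, hxZ, hRZ r hr⟩ (.tail (b := r') ?_ ⟨hyr.symm, hRZ r' hr', hyZ⟩)
    exact (hR r hr r' hr').mono hRZ
  obtain ⟨p, hp⟩ := hreach.exists_walk_length_eq_dist
  set n := p.length with hn
  have hZ : ∀ i, p.getVert i ∈ Z := by
    intro i
    rcases Nat.lt_or_ge i p.length with h | h
    · exact (p.adj_getVert_succ h).2.1
    · rw [p.getVert_of_length_le h]; exact hyZ
  have hdist : ∀ i, i ≤ n → Δ.dist x (p.getVert i) = i := by
    intro i hi
    have h1 := SimpleGraph.dist_le (p.take i)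
    have h2 := SimpleGraph.dist_le (p.drop i)
    have h3 := (p.take i).reachable.dist_triangle_left y
    rw [SimpleGraph.Walk.take_length] at h1
    rw [SimpleGraph.Walk.drop_length] at h2
    omega
  have hn2 : 2 ≤ n := by
    rcases Nat.lt_or_ge n 2 with h | h
    · exfalso
      have h0 := p.getVert_zero
      have hl := p.getVert_length
      interval_cases h' : n
      · rw [← hn] at hl
        exact hxy (h0.symm.trans hl)
      · have := p.adj_getVert_succ (i := 0) (by omega)
        rw [h0, zero_add, hn, hl] at this
        exact hnadj this.1
    · exact h
  have hinj : ∀ i j, i < j → j ≤ n → p.getVert i ≠ p.getVert j := by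
    intro i j hij hj h
    have h1 := hdist i (by omega)
    have h2 := hdist j hj
    rw [h] at h1
    omega
  refine not_isChordalGraph_of_path (Γ := Γ) (p := p.getVert) (s := s) hn2 hinj ?_ ?_ ?_ hΓ
  · intro i j hij hj
    constructor
    · intro h
      have h' : Δ.Adj (p.getVert i) (p.getVert j) := ⟨h, hZ i, hZ j⟩
      have := h'.diff_dist_adj (u := x)
      rw [hdist i (by omega), hdist j hj] at this
      omega
    · rintro rfl
      exact (p.adj_getVert_succ (by omega)).1
  · intro i hi
    constructor
    · intro h
      by_contra hcon
      rcases hZ i with h' | h' | h'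
      · have := hinj 0 i (by omega) hi
        rw [p.getVert_zero] at this
        exact this h'.symm
      · have := hinj i n (by omega) le_rfl
        rw [p.getVert_length] at this
        exact this h'
      · exact hRs _ h' h.symm
    · rintro (rfl | rfl)
      · rw [p.getVert_zero]; exact hsx.symm
      · rw [p.getVert_length]; exact hsy.symm
  · intro i _ h
    rcases hZ i with h' | h' | h'
    · exact hsx.ne (h.symm.trans h')
    · exact hsy.ne (h.symm.trans h')
    · exact hsR (h ▸ h')

/-- In a chordal graph, if every vertex of a clique `B` has a neighbour in the connected set `D`,
then a single vertex of `D` is adjacent to all of `B`. -/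
theorem exists_mem_commonNb [Finite V] (hΓ : IsChordalGraph Γ) {D B : Set V} (hD : ConnSet Γ D)
    (hne : D.Nonempty) (hB : B.Pairwise Γ.Adj) (hBD : ∀ b ∈ B, b ∉ D ∧ ∃ d ∈ D, Γ.Adj d b) :
    ∃ v ∈ D, ∀ b ∈ B, Γ.Adj b v := by
  -- A vertex of `D` with the most neighbours in `B` sees all of `B`: otherwise some vertex of `D`
  -- sees strictly more.
  obtain ⟨v, hvD, hmax⟩ := Set.exists_max_image D (fun v => {b ∈ B | Γ.Adj b v}.ncard)
    (Set.toFinite D) hne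
  refine ⟨v, hvD, fun b hb => ?_⟩
  by_contra hbv
  obtain ⟨hbD, d, hd, hdb⟩ := hBD b hb
  -- Leaving the component of `v` among the non-neighbours of `b` leads to a neighbour `u` of `b`.
  -- By `adj_of_connSet` with apex `b`, `u` inherits all neighbours of `v` in `B`.
  let Z : Set V := {z ∈ D | ¬ Γ.Adj b z}
  have hvZ : v ∈ Z := ⟨hvD, hbv⟩
  obtain ⟨r, u, hr, hu, -, huD, hru⟩ := (hD v hvD d hd).exists_exit (compIn Γ Z v)
    mem_compIn_self (fun h => (compIn_subset hvZ h).2 hdb.symm)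
  have hbu : Γ.Adj b u := by
    by_contra hbu
    exact hu (mem_compIn_of_adj hvZ hr ⟨huD, hbu⟩ hru)
  have hsub : {b ∈ B | Γ.Adj b v} ⊂ {b ∈ B | Γ.Adj b u} := by
    refine ⟨fun b' hb' => ⟨hb'.1, ?_⟩, fun h => hbv (h ⟨hb, hbu⟩).2⟩
    have hbb' : b ≠ b' := by rintro rfl; exact hbv hb'.2
    refine adj_of_connSet hΓ (connSet_compIn hvZ) (fun r hr => (compIn_subset hvZ hr).2)
      (fun h => hbD (compIn_subset hvZ h).1) (hB hb hb'.1 hbb') hbu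
      ⟨v, mem_compIn_self, hb'.2⟩ ⟨r, hr, hru.symm⟩ ?_
    rintro rfl
    exact (hBD _ hb'.1).1 huD
  exact absurd (hmax u huD) (not_le.2 (Set.ncard_lt_ncard hsub (Set.toFinite _)))

end ChordalGraphs

-- Perfect orderings and their extension

section Orderings

variable {V : Type*} {Γ : SimpleGraph V}

/-- In the list `τ`, the neighbours of a vertex which precede it form a clique: the reverse of `τ`
is a perfect elimination ordering. -/
def IsPerfect (Γ : SimpleGraph V) (τ : List V) : Prop :=
  ∀ a b c, [a, c].Sublist τ → [b, c].Sublist τ → Γ.Adj a c → Γ.Adj b c → a ≠ b → Γ.Adj a b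

theorem pair_sublist_concat {a c v : V} {σ : List V} (h : [a, c].Sublist (σ ++ [v])) :
    [a, c].Sublist σ ∨ (a ∈ σ ∧ c = v) := by
  rw [List.sublist_append_iff] at h
  obtain ⟨l₁, l₂, h, h₁, h₂⟩ := h
  rw [List.sublist_singleton] at h₂
  rcases h₂ with rfl | rfl
  · left; simpa [h] using h₁
  · right
    rcases l₁ with _ | ⟨x, _ | ⟨y, l⟩⟩ <;> simp at h
    obtain ⟨rfl, rfl⟩ := h
    exact ⟨by simpa using h₁, rfl⟩

theorem IsPerfect.concat {σ : List V} (hσ : IsPerfect Γ σ) {v : V} (hv : v ∉ σ)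
    (h : ∀ a ∈ σ, ∀ b ∈ σ, Γ.Adj a v → Γ.Adj b v → a ≠ b → Γ.Adj a b) :
    IsPerfect Γ (σ ++ [v]) := by
  intro a b c hac hbc
  have aux : ∀ x, [x, v].Sublist σ → False := fun x hx => hv (hx.subset (by simp))
  rcases pair_sublist_concat hac with h1 | ⟨h1, rfl⟩ <;>
    rcases pair_sublist_concat hbc with h2 | ⟨h2, h2'⟩
  · exact hσ a b c h1 h2
  · subst h2'; exact (aux _ h1).elim
  · exact (aux _ h2).elim
  · exact h a h1 b h2

theorem isPerfect_of_pairwise {σ : List V} {K : Set V} (hσ : ∀ v ∈ σ, v ∈ K)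
    (hK : K.Pairwise Γ.Adj) : IsPerfect Γ σ := fun a b c ha hb _ _ hab =>
  hK (hσ a (ha.subset (by simp))) (hσ b (hb.subset (by simp))) hab

theorem isOrderingOf_concat {P : Set V} {σ : List V} (hσ : IsOrderingOf P σ) {v : V} (hv : v ∉ P) :
    IsOrderingOf (insert v P) (σ ++ [v]) := by
  refine ⟨?_, fun x => ?_⟩
  · rw [List.nodup_append]
    refine ⟨hσ.1, by simp, ?_⟩
    intro a ha b hb hab
    rw [List.mem_singleton] at hb
    exact hv (hb ▸ hab ▸ (hσ.2 a).1 ha)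
  · rw [List.mem_append, List.mem_singleton, hσ.2 x, Set.mem_insert_iff, or_comm]

theorem exists_isOrderingOf [Finite V] (S : Set V) : ∃ τ, IsOrderingOf S τ :=
  ⟨(Set.toFinite S).toFinset.toList, Finset.nodup_toList _, fun v => by simp⟩

/-- A perfect ordering of `P` extends to one of `P ∪ W` as soon as the vertices of `P` with a
neighbour in `D` form a clique, for each connected subset `D` of `W`. -/
theorem exists_isPerfect_append [Finite V] (hΓ : IsChordalGraph Γ) (n : ℕ) :
    ∀ (P W : Set V) (σ : List V), W.ncard = n → IsOrderingOf P σ → IsPerfect Γ σ → Disjoint P W →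
      (∀ D ⊆ W, ConnSet Γ D → (nb Γ D ∩ P).Pairwise Γ.Adj) →
      ∃ ρ, IsOrderingOf (P ∪ W) (σ ++ ρ) ∧ IsPerfect Γ (σ ++ ρ) := by
  induction n with
  | zero =>
    intro P W σ hW hσ hp _ _
    rw [Set.ncard_eq_zero (Set.toFinite W)] at hW
    subst hW
    exact ⟨[], by simpa using hσ, by simpa using hp⟩
  | succ n ih =>
    intro P W σ hW hσ hp hPW h
    obtain ⟨v₀, hv₀⟩ : W.Nonempty := by
      rw [Set.nonempty_iff_ne_empty]; rintro rfl; simp at hW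
    have hDW := compIn_subset (Γ := Γ) hv₀
    have hD := connSet_compIn (Γ := Γ) hv₀
    set D := compIn Γ W v₀ with hDdef
    -- The next vertex sees every visited neighbour of its component `D`; this keeps the clique
    -- hypothesis true after `v` joins `P`.
    obtain ⟨v, hvD, hv⟩ := exists_mem_commonNb hΓ hD ⟨v₀, mem_compIn_self⟩ (h D hDW hD)
      (fun b hb => hb.1)
    have hvW := hDW hvD
    have hvP : v ∉ P := fun h => Set.disjoint_left.1 hPW h hvW
    have hnbv : ∀ a ∈ P, Γ.Adj a v → a ∈ nb Γ D ∩ P := fun a ha hav =>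
      ⟨⟨fun haD => Set.disjoint_left.1 hPW ha (hDW haD), v, hvD, hav.symm⟩, ha⟩
    obtain ⟨ρ, h1, h2⟩ := ih (insert v P) (W \ {v}) (σ ++ [v])
      (by rw [Set.ncard_sdiff_singleton_of_mem hvW, hW]; rfl) (isOrderingOf_concat hσ hvP)
      (hp.concat (fun h => hvP ((hσ.2 v).1 h)) fun a ha b hb hav hbv hab =>
        h D hDW hD (hnbv a ((hσ.2 a).1 ha) hav) (hnbv b ((hσ.2 b).1 hb) hbv) hab)
      (by
        rw [Set.disjoint_left]
        rintro a (rfl | ha) ha'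
        · exact ha'.2 rfl
        · exact Set.disjoint_left.1 hPW ha ha'.1)
      (by
        intro E hE hEc
        have hEW : E ⊆ W := hE.trans Set.sdiff_subset
        -- A connected `E` next to `v` lies in `D`, so its visited neighbours are among those of
        -- `D`, all adjacent to `v`.
        have key : v ∈ nb Γ E → ∀ b ∈ nb Γ E ∩ P, Γ.Adj b v := by
          rintro ⟨-, e, he, hev⟩ b ⟨⟨hbE, e', he', heb⟩, hbP⟩
          have hED : E ⊆ D := hEc.subset_compIn hEW he
            (mem_compIn_of_adj hv₀ hvD (hEW he) hev.symm)
          exact hv b ⟨⟨fun hbD => Set.disjoint_left.1 hPW hbP (hDW hbD), e', hED he', heb⟩, hbP⟩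
        rintro a ⟨ha, rfl | haP⟩ b ⟨hb, rfl | hbP⟩ hab
        · exact absurd rfl hab
        · exact (key ha b ⟨hb, hbP⟩).symm
        · exact key hb a ⟨ha, haP⟩
        · exact h E hEW hEc ⟨ha, haP⟩ ⟨hb, hbP⟩ hab)
    refine ⟨v :: ρ, ?_, by simpa using h2⟩
    have : P ∪ W = insert v P ∪ W \ {v} := by
      ext x
      by_cases hx : x = v
      · subst hx; simp [hvW]
      · simp [hx]
    rw [this]
    simpa using h1

end Orderings

-- Regions left over when a clique and then inner sets are removed

section Regions

variable {V : Type*} {Γ : SimpleGraph V} {U K : Set V}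

/-- The vertices of `D` which are adjacent to all neighbours of `D`. -/
def inner (Γ : SimpleGraph V) (D : Set V) : Set V := D ∩ commonNb Γ (nb Γ D)

/-- The sets of vertices which remain connected while the vertices of `U` are visited, beginning
with those of `K`, by always visiting the inner vertices of a remaining connected set. -/
inductive Region (Γ : SimpleGraph V) (U K : Set V) : Set V → Prop
  | base {v : V} (hv : v ∈ U \ K) : Region Γ U K (compIn Γ (U \ K) v)
  | step {D : Set V} {v : V} (hD : Region Γ U K D) (hv : v ∈ D \ inner Γ D) :
      Region Γ U K (compIn Γ (D \ inner Γ D) v)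

theorem Region.connSet {D : Set V} (h : Region Γ U K D) : ConnSet Γ D := by
  cases h with
  | base hv => exact connSet_compIn hv
  | step _ hv => exact connSet_compIn hv

theorem Region.nonempty {D : Set V} (h : Region Γ U K D) : D.Nonempty := by
  cases h <;> exact ⟨_, mem_compIn_self⟩

theorem Region.subset {D : Set V} (h : Region Γ U K D) : D ⊆ U \ K := by
  induction h with
  | base hv => exact compIn_subset hv
  | step _ hv ih => exact (compIn_subset hv).trans (Set.sdiff_subset.trans ih)

theorem nb_compIn_diff_subset (hU : ∀ a b, Γ.Adj a b → b ∈ U) {v : V} (hv : v ∈ U \ K) :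
    nb Γ (compIn Γ (U \ K) v) ⊆ K := by
  intro b hb
  by_contra hbK
  obtain ⟨-, d, -, hdb⟩ := id hb
  exact not_mem_of_mem_nb_compIn hv hb ⟨hU _ _ hdb, hbK⟩

theorem nb_compIn_diff_inner_subset {D : Set V} {v : V} (hv : v ∈ D \ inner Γ D) :
    nb Γ (compIn Γ (D \ inner Γ D) v) ⊆ nb Γ D ∪ inner Γ D := by
  intro b hb
  have hbD := not_mem_of_mem_nb_compIn hv hb
  obtain ⟨-, d, hd, hdb⟩ := hb
  by_cases h : b ∈ D
  · right
    by_contra h'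
    exact hbD ⟨h, h'⟩
  · exact Or.inl ⟨h, d, (compIn_subset hv hd).1, hdb⟩

/-- New boundary vertices come from the old boundary or from the inner set, and these two are
completely joined. The only real case is two inner vertices with neighbours in the same new region.
-/
theorem Region.pairwise_nb (hΓ : IsChordalGraph Γ) (hU : ∀ a b, Γ.Adj a b → b ∈ U)
    (hK : K.Pairwise Γ.Adj) {D : Set V} (h : Region Γ U K D) : (nb Γ D).Pairwise Γ.Adj := by
  induction h with
  | base hv => exact hK.mono (nb_compIn_diff_subset hU hv)
  | @step D v hD hv ih =>
    set E := compIn Γ (D \ inner Γ D) v with hE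
    have hEsub : E ⊆ D \ inner Γ D := compIn_subset hv
    intro s hs t ht hst
    rcases nb_compIn_diff_inner_subset hv hs with hs' | hs' <;>
      rcases nb_compIn_diff_inner_subset hv ht with ht' | ht'
    · exact ih hs' ht' hst
    · exact ht'.2 s hs'
    · exact (hs'.2 t ht').symm
    by_contra hnadj
    obtain ⟨hsE, p₀, hp₀, hp₀s⟩ := hs
    obtain ⟨htE, q₀, hq₀, hq₀t⟩ := ht
    have hconn : ConnSet Γ (insert t E) := connSet_insert (connSet_compIn hv) hq₀ hq₀t
    -- If `s` and `t` were nonadjacent, a path from `t` through `E` would reach a neighbour `p` of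
    -- `s`. By `adj_of_connSet` with apex `s`, `p` sees all of `nb Γ D`, so `p` would itself be
    -- inner.
    let Z : Set V := {z ∈ insert t E | ¬ Γ.Adj s z}
    have htZ : t ∈ Z := ⟨Set.mem_insert _ _, hnadj⟩
    obtain ⟨r, p, hr, hp, -, hpE, hrp⟩ := (hconn t (Set.mem_insert _ _) p₀
      (Set.mem_insert_of_mem _ hp₀)).exists_exit (compIn Γ Z t) mem_compIn_self
        (fun h => (compIn_subset htZ h).2 hp₀s.symm)
    have hsp : Γ.Adj s p := by
      by_contra hsp
      exact hp (mem_compIn_of_adj htZ hr ⟨hpE, hsp⟩ hrp)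
    have hpE' : p ∈ E := by
      rcases hpE with rfl | h
      · exact absurd mem_compIn_self hp
      · exact h
    refine (hEsub hpE').2 ⟨(hEsub hpE').1, fun b hb => ?_⟩
    refine adj_of_connSet hΓ (connSet_compIn htZ) (fun r hr => (compIn_subset htZ hr).2) ?_
      (hs'.2 b hb).symm hsp ⟨t, mem_compIn_self, ht'.2 b hb⟩ ⟨r, hr, hrp.symm⟩ ?_
    · intro h
      rcases (compIn_subset htZ h).1 with h | h
      · exact hst h
      · exact hsE h
    · rintro rfl
      exact hb.1 (hEsub hpE').1

theorem Region.inner_nonempty [Finite V] (hΓ : IsChordalGraph Γ) (hU : ∀ a b, Γ.Adj a b → b ∈ U)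
    (hK : K.Pairwise Γ.Adj) {D : Set V} (h : Region Γ U K D) : (inner Γ D).Nonempty := by
  obtain ⟨v, hv, h'⟩ := exists_mem_commonNb hΓ h.connSet h.nonempty (h.pairwise_nb hΓ hU hK)
    (fun _ hb => hb)
  exact ⟨v, hv, h'⟩

/-- The boundary never swallows all of the preceding clique (`K`, or the boundary of the parent
region): otherwise a vertex of the region would extend `K` or be inner in the parent. A vertex of
that clique left out is the witness. -/
theorem Region.exists_mem_commonNb [Finite V] (hΓ : IsChordalGraph Γ)
    (hU : ∀ a b, Γ.Adj a b → b ∈ U) (hK : K.Pairwise Γ.Adj)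
    (hmax : ∀ v ∈ U, ¬ ∀ k ∈ K, Γ.Adj k v) {D : Set V} (h : Region Γ U K D) :
    ∃ w, w ∉ D ∧ w ∈ commonNb Γ (nb Γ D) := by
  have aux := h
  cases h with
  | @base v hv =>
    obtain ⟨w, hwK, hw⟩ : ∃ w ∈ K, w ∉ nb Γ (compIn Γ (U \ K) v) := by
      by_contra! hcon
      obtain ⟨p, hp, hp'⟩ := CliquePicking.exists_mem_commonNb hΓ aux.connSet aux.nonempty hK
        (fun b hb => hcon b hb)
      exact hmax p (aux.subset hp).1 hp'
    refine ⟨w, fun h => (aux.subset h).2 hwK, fun b hb => ?_⟩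
    exact hK (nb_compIn_diff_subset hU hv hb) hwK (fun h => hw (h ▸ hb))
  | @step D v hD hv =>
    obtain ⟨w, hwD, hw⟩ : ∃ w ∈ nb Γ D, w ∉ nb Γ (compIn Γ (D \ inner Γ D) v) := by
      by_contra! hcon
      obtain ⟨p, hp, hp'⟩ := CliquePicking.exists_mem_commonNb hΓ aux.connSet aux.nonempty
        (aux.pairwise_nb hΓ hU hK) (fun _ hb => hb)
      exact (compIn_subset hv hp).2 ⟨(compIn_subset hv hp).1, fun b hb => hp' b (hcon b hb)⟩
    refine ⟨w, fun h => hwD.1 (compIn_subset hv h).1, fun b hb => ?_⟩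
    rcases nb_compIn_diff_inner_subset hv hb with h | h
    · exact hD.pairwise_nb hΓ hU hK h hwD (fun h => hw (h ▸ hb))
    · exact (h.2 w hwD).symm

/-- In a moral orientation in which no edge enters `K`, no edge leaves a region. -/
theorem Region.not_arc (hU : ∀ a b, Γ.Adj a b → b ∈ U)
    {A : V → V → Prop} (hA : ∀ a b, Γ.Adj a b → A a b ∨ A b a)
    (hmoral : ∀ a b c, A a b → A c b → a ≠ c → Γ.Adj a c)
    (hAK : ∀ k ∈ K, ∀ d, d ∉ K → ¬ A d k) {D : Set V} (h : Region Γ U K D) :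
    ∀ b ∈ nb Γ D, ∀ d ∈ D, ¬ A d b := by
  induction h with
  | base hv =>
    exact fun b hb d hd => hAK b (nb_compIn_diff_subset hU hv hb) d (compIn_subset hv hd).2
  | step _ hv ih =>
    intro s hs c hc hcs
    have hcD := compIn_subset hv hc
    rcases nb_compIn_diff_inner_subset hv hs with h | h
    · exact ih s h c hcD.1 hcs
    -- For every boundary vertex `b` of the old region, b → s ← c forces `b` and `c` to be adjacent,
    -- which would make `c` inner.
    · refine hcD.2 ⟨hcD.1, fun b hb => ?_⟩
      refine hmoral b s c ?_ hcs (fun h => hb.1 (h ▸ hcD.1))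
      exact (hA b s (h.2 b hb)).resolve_right (ih b hb s h.1)

/-- Inner sets are nonempty, so passing to the subregion that contains `v` strictly shrinks the
region. -/
theorem Region.exists_mem_inner_of_mem [Finite V] (hΓ : IsChordalGraph Γ)
    (hU : ∀ a b, Γ.Adj a b → b ∈ U) (hK : K.Pairwise Γ.Adj) {v : V} (n : ℕ) :
    ∀ D : Set V, D.ncard ≤ n → Region Γ U K D → v ∈ D → ∃ E, Region Γ U K E ∧ v ∈ inner Γ E := by
  induction n with
  | zero =>
    intro D hn _ hv
    rw [Nat.le_zero, Set.ncard_eq_zero (Set.toFinite D)] at hn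
    simp [hn] at hv
  | succ n ih =>
    intro D hn h hv
    by_cases hvi : v ∈ inner Γ D
    · exact ⟨D, h, hvi⟩
    · have hm : v ∈ D \ inner Γ D := ⟨hv, hvi⟩
      refine ih _ ?_ (h.step hm) mem_compIn_self
      obtain ⟨x, hx⟩ := h.inner_nonempty hΓ hU hK
      have hss : compIn Γ (D \ inner Γ D) v ⊂ D :=
        ⟨(compIn_subset hm).trans Set.sdiff_subset,
          fun h => (compIn_subset hm (h hx.1)).2 hx⟩
      have := Set.ncard_lt_ncard hss (Set.toFinite _)
      omega

theorem exists_region_mem_inner [Finite V] (hΓ : IsChordalGraph Γ)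
    (hU : ∀ a b, Γ.Adj a b → b ∈ U) (hK : K.Pairwise Γ.Adj) {v : V} (hv : v ∈ U \ K) :
    ∃ D, Region Γ U K D ∧ v ∈ inner Γ D :=
  Region.exists_mem_inner_of_mem hΓ hU hK _ _ le_rfl (Region.base hv) mem_compIn_self

/-- The vertices of an inner set can be visited in any order. -/
theorem Region.exists_isPerfect [Finite V] (hΓ : IsChordalGraph Γ)
    (hU : ∀ a b, Γ.Adj a b → b ∈ U) (hKU : K ⊆ U) (hK : K.Pairwise Γ.Adj) {D : Set V}
    (h : Region Γ U K D) {u v : V} (hu : u ∈ inner Γ D) (hv : v ∈ inner Γ D) (huv : u ≠ v) :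
    ∃ π ρ, IsOrderingOf K π ∧ IsOrderingOf U (π ++ ρ) ∧ IsPerfect Γ (π ++ ρ) ∧
      [u, v].Sublist (π ++ ρ) := by
  have hDU := h.subset
  have hnb := h.pairwise_nb hΓ hU hK
  obtain ⟨π, hπ⟩ := exists_isOrderingOf K
  -- Visit `K`, then everything else outside `D`, then `u`, then the rest of `D`. Starting `D` at
  -- `u` is allowed because `u` is joined to the whole boundary clique.
  obtain ⟨ρ₁, h1, h1'⟩ := exists_isPerfect_append hΓ _ K ((U \ K) \ D) π rfl hπ
    (isPerfect_of_pairwise (fun v hv => (hπ.2 v).1 hv) hK)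
    (by rw [Set.disjoint_left]; exact fun a ha ha' => ha'.1.2 ha)
    (fun E _ _ => hK.mono Set.inter_subset_right)
  have hUD : K ∪ (U \ K) \ D = U \ D := by
    ext x
    have h1 := @hKU x
    have h2 := @hDU x
    simp only [Set.mem_union, Set.mem_sdiff] at *
    tauto
  rw [hUD] at h1
  have hsub : ∀ E ⊆ D, nb Γ E ∩ (U \ D) ⊆ nb Γ D := by
    rintro E hE b ⟨⟨-, e, he, heb⟩, hb⟩
    exact ⟨hb.2, e, hE he, heb⟩
  have hnbu : ∀ a ∈ U \ D, Γ.Adj a u → a ∈ nb Γ D := fun a ha hau => ⟨ha.2, u, hu.1, hau.symm⟩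
  have huP : u ∉ U \ D := fun h => h.2 hu.1
  obtain ⟨ρ₂, h2, h2'⟩ := exists_isPerfect_append hΓ _ (insert u (U \ D)) (D \ {u}) _ rfl
    (isOrderingOf_concat h1 huP)
    (h1'.concat (fun h => huP ((h1.2 u).1 h)) fun a ha b hb hau hbu hab =>
      hnb (hnbu a ((h1.2 a).1 ha) hau) (hnbu b ((h1.2 b).1 hb) hbu) hab)
    (by
      rw [Set.disjoint_left]
      rintro a (rfl | ha) ha'
      · exact ha'.2 rfl
      · exact ha.2 ha'.1)
    (by
      intro E hE _
      have hED := hsub E (hE.trans Set.sdiff_subset)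
      rintro a ⟨ha, rfl | haP⟩ b ⟨hb, rfl | hbP⟩ hab
      · exact absurd rfl hab
      · exact (hu.2 b (hED ⟨hb, hbP⟩)).symm
      · exact hu.2 a (hED ⟨ha, haP⟩)
      · exact hnb (hED ⟨ha, haP⟩) (hED ⟨hb, hbP⟩) hab)
  have hU' : insert u (U \ D) ∪ D \ {u} = U := by
    ext x
    have h2 := @hDU x
    by_cases hx : x = u
    · subst hx; simp [(hDU hu.1).1]
    · simp only [Set.mem_union, Set.mem_sdiff, Set.mem_insert_iff, hx, false_or,
        Set.mem_singleton_iff, not_false_eq_true, and_true] at *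
      tauto
  rw [hU'] at h2
  refine ⟨π, ρ₁ ++ ([u] ++ ρ₂), hπ, by simpa using h2, by simpa using h2', ?_⟩
  have hv₂ : v ∈ ρ₂ := by
    have := (h2.2 v).2 (hDU hv.1).1
    simp only [List.mem_append, List.mem_singleton] at this
    rcases this with h | h
    · rcases h with h | h
      · exact (((h1.2 v).1 (List.mem_append.2 h)).2 hv.1).elim
      · exact absurd h huv.symm
    · exact h
  rw [← List.append_assoc]
  refine List.Sublist.trans ?_ (List.sublist_append_right _ _)
  exact List.Sublist.append (List.Sublist.refl [u]) (List.singleton_sublist.2 hv₂)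

end Regions

-- Undirected components are petals, and petals are hereditary

section Components

variable {V : Type*} {G : SimpleGraph V}

theorem reflTransGen_of_connected {C : G.Subgraph} (h : C.Connected) {x y : V} (hx : x ∈ C.verts)
    (hy : y ∈ C.verts) : Relation.ReflTransGen C.Adj x y := by
  have := h.coe.preconnected ⟨x, hx⟩ ⟨y, hy⟩
  rw [SimpleGraph.reachable_iff_reflTransGen] at this
  exact this.lift Subtype.val fun a b h => h

theorem connected_of_reflTransGen {C : G.Subgraph} (hne : C.verts.Nonempty)
    (h : ∀ x ∈ C.verts, ∀ y ∈ C.verts, Relation.ReflTransGen C.Adj x y) : C.Connected := by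
  have key : ∀ x y (hx : x ∈ C.verts) (hy : y ∈ C.verts), Relation.ReflTransGen C.Adj x y →
      C.coe.Reachable ⟨x, hx⟩ ⟨y, hy⟩ := by
    intro x y hx hy hxy
    induction hxy with
    | refl => exact .refl _
    | @tail b c _ hbc ih =>
      have hadj : C.coe.Adj ⟨b, C.edge_vert hbc⟩ ⟨c, hy⟩ := hbc
      exact (ih (C.edge_vert hbc)).trans hadj.reachable
  have : Nonempty C.verts := hne.to_subtype
  exact ⟨⟨fun x y => key x y x.2 y.2 (h x x.2 y y.2)⟩⟩

theorem connSet_verts {H : G.Subgraph} (h : H.Connected) : ConnSet H.spanningCoe H.verts :=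
  fun _ hx _ hy => Relation.ReflTransGen.mono
    (fun _ _ hab => ⟨hab, H.edge_vert hab, H.edge_vert hab.symm⟩) _ _
    (reflTransGen_of_connected h hx hy)

theorem connected_induce {H : G.Subgraph} {Y : Set V} (hne : Y.Nonempty)
    (h : ConnSet H.spanningCoe Y) : (H.induce Y).Connected :=
  connected_of_reflTransGen hne fun x hx y hy => Relation.ReflTransGen.mono
    (fun _ _ hab => ⟨hab.2.1, hab.2.2, hab.1⟩) _ _ (h x hx y hy)

theorem isAMO_of_isPerfect {H : G.Subgraph} {τ : List V} (hτ : IsOrderingOf H.verts τ)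
    (hp : IsPerfect H.spanningCoe τ) : IsAMO H fun a b => H.Adj a b ∧ [a, b].Sublist τ := by
  classical
  have hidx : ∀ a b, [a, b].Sublist τ → τ.idxOf a < τ.idxOf b := by
    intro a b h
    have hnd := hτ.1
    clear hτ hp
    induction τ with
    | nil => simp at h
    | cons c τ ih =>
      rw [List.nodup_cons] at hnd
      cases h with
      | cons _ h =>
        have ha : c ≠ a := fun hc => hnd.1 (hc ▸ h.subset (by simp))
        have hb : c ≠ b := fun hc => hnd.1 (hc ▸ h.subset (by simp))
        rw [List.idxOf_cons_ne _ ha, List.idxOf_cons_ne _ hb]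
        exact Nat.succ_lt_succ (ih h hnd.2)
      | cons_cons _ h =>
        have hb : a ≠ b := fun hc => hnd.1 (hc ▸ h.subset (by simp))
        rw [List.idxOf_cons_self, List.idxOf_cons_ne _ hb]
        exact Nat.succ_pos _
  refine ⟨⟨fun u v => ⟨fun h => ?_, ?_⟩, fun u v h h' => ?_⟩, fun v h => ?_, ?_⟩
  · have hu := (hτ.2 u).2 (H.edge_vert h)
    have hv := (hτ.2 v).2 (H.edge_vert h.symm)
    obtain ⟨l₁, l₂, hl⟩ := List.append_of_mem hu
    subst hl
    simp only [List.mem_append, List.mem_cons] at hv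
    rcases hv with hv | rfl | hv
    · exact Or.inr ⟨h.symm, List.Sublist.append (List.singleton_sublist.2 hv)
        (List.singleton_sublist.2 (by simp))⟩
    · exact absurd rfl h.ne
    · exact Or.inl ⟨h, List.Sublist.trans (List.Sublist.cons_cons _ (List.singleton_sublist.2 hv))
        (List.sublist_append_right _ _)⟩
  · rintro (h | h)
    exacts [h.1, h.1.symm]
  · exact absurd (hidx _ _ h.2) (not_lt.2 (hidx _ _ h'.2).le)
  · have key : ∀ x y, Relation.TransGen (fun a b => H.Adj a b ∧ [a, b].Sublist τ) x y →
        τ.idxOf x < τ.idxOf y := by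
      intro x y hxy
      induction hxy with
      | single h => exact hidx _ _ h.2
      | tail _ h ih => exact ih.trans (hidx _ _ h.2)
    exact lt_irrefl _ (key v v h)
  · exact fun a b c hab hcb hac => hp a c b hab.2 hcb.2 hab.1 hcb.1 hac

/-- A petal of `Γ` is a connected component of the common neighbourhood of a nonempty clique `S`
whose common neighbourhood is disconnected. -/
def IsPetal (Γ : SimpleGraph V) (Y : Set V) : Prop :=
  ∃ S : Set V, S.Nonempty ∧ S.Pairwise Γ.Adj ∧ ∃ v ∈ commonNb Γ S,
    Y = compIn Γ (commonNb Γ S) v ∧ ∃ w ∈ commonNb Γ S, w ∉ Y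

/-- A path of common neighbours leaving `D` would step onto a vertex of `nb Γ D`, which would then
be adjacent to itself. -/
theorem compIn_inner_eq {Γ : SimpleGraph V} {D : Set V} {v : V} (hv : v ∈ inner Γ D) :
    compIn Γ (inner Γ D) v = compIn Γ (commonNb Γ (nb Γ D)) v := by
  refine Set.Subset.antisymm (fun z hz => ReachIn.mono Set.inter_subset_right hz) fun z hz => ?_
  change ReachIn _ _ _ _ at hz
  induction hz with
  | refl => exact mem_compIn_self
  | tail _ h ih =>
    refine mem_compIn_of_adj hv ih ⟨?_, h.2.2⟩ h.1
    by_contra hcD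
    exact (h.2.2 _ ⟨hcD, _, (compIn_subset hv ih).1, h.1⟩).ne rfl

theorem cliqueOrientation_of_mem_inner [Finite V] {H : G.Subgraph}
    (hΓ : IsChordalGraph H.spanningCoe) {K D : Set V} (hKU : K ⊆ H.verts)
    (hK : K.Pairwise H.Adj) (hD : Region H.spanningCoe H.verts K D) {u v : V}
    (hu : u ∈ inner H.spanningCoe D) (hv : v ∈ inner H.spanningCoe D) (h : H.Adj u v) :
    cliqueOrientation H K u v := by
  obtain ⟨π, ρ, hπ, hτ, hp, huv⟩ := hD.exists_isPerfect hΓ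
    (fun _ _ h => H.edge_vert (H.symm.symm _ _ h)) hKU hK hu hv h.ne
  exact ⟨π, hπ, _, isAMO_of_isPerfect hτ hp, ⟨_, ⟨hτ, fun _ _ h => h.2⟩, List.prefix_append _ _⟩,
    h, huv⟩

theorem not_cliqueOrientation_of_region {H : G.Subgraph} {K D : Set V}
    (hD : Region H.spanningCoe H.verts K D) {b d : V} (hb : b ∈ nb H.spanningCoe D) (hd : d ∈ D) :
    ¬ cliqueOrientation H K d b := by
  rintro ⟨π, hπ, A, hA, ⟨τ, hτ, ρ, rfl⟩, hdb⟩
  refine hD.not_arc (A := A) (fun _ _ h => H.edge_vert (H.symm.symm _ _ h))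
    (fun a b h => (hA.orientation.1 a b).1 h) hA.moral ?_ b hb d hd hdb
  intro k hk d hd hdk
  have hsub := hτ.2 _ _ hdk
  have hnd := hτ.1.1
  have hkπ := (hπ.2 k).2 hk
  have hdπ : d ∉ π := fun h => hd ((hπ.2 d).1 h)
  rw [List.sublist_append_iff] at hsub
  obtain ⟨l₁, l₂, hl, h₁, h₂⟩ := hsub
  rw [List.nodup_append] at hnd
  rcases l₁ with _ | ⟨x, l₁⟩
  · simp only [List.nil_append] at hl
    subst hl
    exact hnd.2.2 k hkπ k (h₂.subset (by simp)) rfl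
  · simp only [List.cons_append, List.cons.injEq] at hl
    exact hdπ (hl.1 ▸ h₁.subset (by simp))

/-- One of the two directions would otherwise leave a region: `D` itself if `v` is outside it, or
the subregion of `v` if `v` is in `D` but not inner. -/
theorem mem_inner_of_bidirected {H : G.Subgraph} {K D : Set V}
    (hD : Region H.spanningCoe H.verts K D) {u v : V} (hu : u ∈ inner H.spanningCoe D)
    (huv : (undirectedPart H K).Adj u v) : v ∈ inner H.spanningCoe D := by
  obtain ⟨-, h, h'⟩ := huv
  have hadj : H.spanningCoe.Adj u v := cliqueOrientation_adj h
  by_cases hvD : v ∈ D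
  · by_contra hv
    have hm : v ∈ D \ inner H.spanningCoe D := ⟨hvD, hv⟩
    exact not_cliqueOrientation_of_region (hD.step hm)
      (b := u) ⟨fun h => (compIn_subset hm h).2 hu, v, mem_compIn_self, hadj.symm⟩
      mem_compIn_self h'
  · exact (not_cliqueOrientation_of_region hD ⟨hvD, u, hu.1, hadj⟩ hu.1 h).elim

/-- The elements of `𝒞_H(K)` are induced by petals of `H`. -/
theorem exists_isPetal_of_mem_components [Finite V] {H C : G.Subgraph}
    (hΓ : IsChordalGraph H.spanningCoe) (hH : H.Connected) {K : Set V} (hK : K ∈ maxCliques H)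
    (hC : C ∈ components H K) :
    ∃ Y ⊆ H.verts \ K, IsPetal H.spanningCoe Y ∧ C = H.induce Y := by
  obtain ⟨⟨hCU, hCconn⟩, hCmax⟩ := hC
  obtain ⟨⟨hKU, hKc⟩, hKmax⟩ := hK
  have hU : ∀ a b, H.spanningCoe.Adj a b → b ∈ H.verts :=
    fun _ _ h => H.edge_vert (H.symm.symm _ _ h)
  have hmax : ∀ v ∈ H.verts, ¬ ∀ k ∈ K, H.spanningCoe.Adj k v := by
    intro v hv h
    have hvK : v ∈ K := by
      refine hKmax ⟨Set.insert_subset hv hKU, ?_⟩ (Set.subset_insert v K) (Set.mem_insert v K)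
      rintro a (rfl | ha) b (rfl | hb) hab
      · exact absurd rfl hab
      · exact (h b hb).symm
      · exact h a ha
      · exact hKc ha hb hab
    exact (h v hvK).ne rfl
  obtain ⟨v, hv⟩ := hCconn.nonempty
  obtain ⟨D, hD, hvD⟩ := exists_region_mem_inner hΓ hU hKc (hCU.1 hv)
  set X := inner H.spanningCoe D with hX
  have hXU : X ⊆ H.verts \ K := Set.inter_subset_left.trans hD.subset
  have hYX := compIn_subset (Γ := H.spanningCoe) hvD
  refine ⟨compIn H.spanningCoe X v, hYX.trans hXU, ?_, ?_⟩
  · refine ⟨nb H.spanningCoe D, ?_, hD.pairwise_nb hΓ hU hKc, v, hvD.2, compIn_inner_eq hvD, ?_⟩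
    · obtain ⟨k, hk⟩ : K.Nonempty := by
        rw [Set.nonempty_iff_ne_empty]
        rintro rfl
        exact hmax v (hXU hvD).1 (by simp)
      obtain ⟨a, b, ha, hb, -, -, hab⟩ := (connSet_verts hH v (hXU hvD).1 k (hKU hk)).exists_exit D
        hvD.1 (fun h => (hD.subset h).2 hk)
      exact ⟨b, hb, a, ha, hab⟩
    · obtain ⟨w, hw, hw'⟩ := hD.exists_mem_commonNb hΓ hU hKc hmax
      exact ⟨w, hw', fun h => hw (hYX h).1⟩
  · have hle : C ≤ H.induce (compIn H.spanningCoe X v) := by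
      have hverts : C.verts ⊆ compIn H.spanningCoe X v := by
        intro z hz
        have := reflTransGen_of_connected hCconn hv hz
        clear hz
        induction this with
        | refl => exact mem_compIn_self
        | tail _ h ih =>
          have hu := hCU.2 h
          exact mem_compIn_of_adj hvD ih (mem_inner_of_bidirected hD (hYX ih) hu)
            (cliqueOrientation_adj hu.2.1)
      exact ⟨hverts, fun a b h => ⟨hverts (C.edge_vert h), hverts (C.edge_vert h.symm),
        cliqueOrientation_adj (hCU.2 h).2.1⟩⟩
    refine le_antisymm hle (hCmax ⟨⟨hYX.trans hXU, ?_⟩, ?_⟩ hle)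
    · rintro a b ⟨ha, hb, hab⟩
      exact ⟨⟨(hXU (hYX ha)).2, (hXU (hYX hb)).2⟩,
        cliqueOrientation_of_mem_inner hΓ hKU hKc hD (hYX ha) (hYX hb) hab,
        cliqueOrientation_of_mem_inner hΓ hKU hKc hD (hYX hb) (hYX ha) hab.symm⟩
    · exact connected_induce ⟨v, mem_compIn_self⟩ (connSet_compIn hvD)

/-- A graph which `count` may be called on: `G` itself, or a petal of `G`. -/
def IsExplorable (H : G.Subgraph) : Prop :=
  H = ⊤ ∨ ∃ Y, IsPetal G Y ∧ H = (⊤ : G.Subgraph).induce Y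

theorem isChordalGraph_spanningCoe_induce (hG : IsChordalGraph G) (Y : Set V) :
    IsChordalGraph ((⊤ : G.Subgraph).induce Y).spanningCoe := by
  intro n hn
  refine ⟨fun f => (hG n hn).false ⟨f.toEmbedding, ?_⟩⟩
  -- Vertices outside `Y` are isolated in the spanning graph, whereas every vertex of a cycle has a
  -- neighbour.
  have hY : ∀ a, f a ∈ Y := by
    intro a
    obtain ⟨m, rfl⟩ : ∃ m, n = m + 2 := ⟨n - 2, by omega⟩
    have h : (SimpleGraph.cycleGraph (m + 2)).Adj a (a + 1) := by
      rw [SimpleGraph.cycleGraph_adj]; right; simp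
    exact (f.map_rel_iff.2 h).1
  intro a b
  rw [← f.map_rel_iff]
  exact ⟨fun h => ⟨hY a, hY b, h⟩, fun h => h.2.2⟩

theorem IsPetal.connSet {Γ : SimpleGraph V} {Y : Set V} (h : IsPetal Γ Y) : ConnSet Γ Y := by
  obtain ⟨S, -, -, v, hv, rfl, -⟩ := h
  exact connSet_compIn hv

theorem IsPetal.nonempty {Γ : SimpleGraph V} {Y : Set V} (h : IsPetal Γ Y) : Y.Nonempty := by
  obtain ⟨S, -, -, v, hv, rfl, -⟩ := h
  exact ⟨v, mem_compIn_self⟩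

theorem connected_top (hG : G.Connected) : (⊤ : G.Subgraph).Connected := by
  have := hG.nonempty
  refine connected_of_reflTransGen Set.univ_nonempty fun x _ y _ => ?_
  exact (SimpleGraph.reachable_iff_reflTransGen x y).1 (hG.preconnected x y)

theorem IsExplorable.connected (hG : G.Connected) {H : G.Subgraph} (h : IsExplorable H) :
    H.Connected := by
  rcases h with rfl | ⟨Y, hY, rfl⟩
  · exact connected_top hG
  · exact connected_induce hY.nonempty hY.connSet

theorem IsExplorable.isChordalGraph (hG : IsChordalGraph G) {H : G.Subgraph}
    (h : IsExplorable H) : IsChordalGraph H.spanningCoe := by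
  rcases h with rfl | ⟨Y, hY, rfl⟩
  · exact hG
  · exact isChordalGraph_spanningCoe_induce hG Y

theorem IsExplorable.isUCCG (hG : IsUCCG G) {H : G.Subgraph} (h : IsExplorable H) :
    IsUCCG H.coe := by
  refine ⟨(h.connected hG.1).coe, fun n hn => ⟨fun f => ?_⟩⟩
  refine ((h.isChordalGraph hG.2) n hn).false
    ⟨f.toEmbedding.trans (Function.Embedding.subtype _), ?_⟩
  intro a b
  exact f.map_rel_iff

/-- The clique S ∪ R defines `Y` in `G`: a common neighbour of `S` that is adjacent to some vertex
of R ⊆ Z lies in the component `Z`. This is where R being nonempty matters. -/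
theorem IsPetal.trans {Y Z : Set V} (hZ : IsPetal G Z)
    (hY : IsPetal ((⊤ : G.Subgraph).induce Z).spanningCoe Y) : IsPetal G Y := by
  obtain ⟨S, hSne, hSc, v, hv, rfl, -⟩ := hZ
  set Z := compIn G (commonNb G S) v with hZ
  obtain ⟨R, hRne, hRc, w, hw, rfl, w', hw', hne⟩ := hY
  set Γ := ((⊤ : G.Subgraph).induce Z).spanningCoe with hΓ
  have hadj : ∀ a b, Γ.Adj a b ↔ a ∈ Z ∧ b ∈ Z ∧ G.Adj a b := fun a b => Iff.rfl
  have hRZ : R ⊆ Z := fun r hr => ((hadj _ _).1 (hw r hr)).1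
  have hZS := compIn_subset (Γ := G) hv
  have hcn : commonNb G (S ∪ R) = commonNb Γ R := by
    ext x
    constructor
    · intro hx r hr
      refine ⟨hRZ hr, ?_, hx r (Or.inr hr)⟩
      exact mem_compIn_of_adj hv (hRZ hr) (fun s hs => hx s (Or.inl hs)) (hx r (Or.inr hr))
    · intro hx s hs
      obtain ⟨r, hr⟩ := hRne
      rcases hs with hs | hs
      · exact hZS ((hadj _ _).1 (hx r hr)).2.1 s hs
      · exact ((hadj _ _).1 (hx s hs)).2.2
  have hcnZ : ∀ x ∈ commonNb Γ R, x ∈ Z := by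
    intro x hx
    obtain ⟨r, hr⟩ := hRne
    exact ((hadj _ _).1 (hx r hr)).2.1
  have hcomp : compIn Γ (commonNb Γ R) w = compIn G (commonNb Γ R) w := by
    have : (fun a b => Γ.Adj a b ∧ a ∈ commonNb Γ R ∧ b ∈ commonNb Γ R) =
        fun a b => G.Adj a b ∧ a ∈ commonNb Γ R ∧ b ∈ commonNb Γ R := by
      funext a b
      refine propext ⟨fun h => ⟨h.1.2.2, h.2⟩, fun h => ⟨⟨hcnZ a h.2.1, hcnZ b h.2.2, h.1⟩, h.2⟩⟩
    unfold compIn ReachIn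
    rw [this]
  refine ⟨S ∪ R, hSne.mono Set.subset_union_left, ?_, w, hcn ▸ hw, by rw [hcn, hcomp], w',
    hcn ▸ hw', hne⟩
  rintro a (ha | ha) b (hb | hb) hab
  · exact hSc ha hb hab
  · exact hZS (hRZ hb) a ha
  · exact (hZS (hRZ ha) b hb).symm
  · exact (hRc ha hb hab).2.2

theorem IsExplorable.of_mem_components [Finite V] (hG : IsUCCG G) {H C : G.Subgraph}
    (h : IsExplorable H) {K : Set V} (hK : K ∈ maxCliques H) (hC : C ∈ components H K) :
    IsExplorable C := by
  obtain ⟨Y, hYH, hY, rfl⟩ := exists_isPetal_of_mem_components (h.isChordalGraph hG.2)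
    (h.connected hG.1) hK hC
  rcases h with rfl | ⟨Z, hZ, rfl⟩
  · exact Or.inr ⟨Y, hY, rfl⟩
  · refine Or.inr ⟨Y, hZ.trans hY, ?_⟩
    have hYZ : Y ⊆ Z := fun y hy => (hYH hy).1
    ext a b
    · rfl
    · exact ⟨fun h => ⟨h.1, h.2.1, h.2.2.2.2⟩, fun h => ⟨h.1, h.2.1, hYZ h.1, hYZ h.2.1, h.2.2⟩⟩

end Components

-- Running intersection orders

section RunningIntersection

variable {V : Type*}

/-- Lists of sets with the running intersection property, the last set first. -/
inductive RunningIntersection : List (Set V) → Prop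
  | single (K : Set V) : RunningIntersection [K]
  | cons {J M : Set V} {L : List (Set V)} (h : RunningIntersection L) (hJ : J ∈ L)
      (hM : ∀ N ∈ L, M ∩ N ⊆ J) (hML : M ∉ L) : RunningIntersection (M :: L)

/-- Ranks follow the order of insertion: a new set gets a strict upper bound of the earlier ranks,
and `J` as parent. -/
theorem RunningIntersection.exists_parent {L : List (Set V)} (h : RunningIntersection L) :
    ∃ (rank : Set V → ℕ) (par : Set V → Set V) (root : Set V), root ∈ L ∧
      (∃ b, ∀ N ∈ L, rank N < b) ∧
      (∀ M ∈ L, ∀ N ∈ L, rank M = rank N → M = N) ∧ (∀ N ∈ L, rank root ≤ rank N) ∧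
      ∀ M ∈ L, M ≠ root → par M ∈ L ∧ rank (par M) < rank M ∧
        ∀ N ∈ L, rank N < rank M → M ∩ N ⊆ par M := by
  classical
  induction h with
  | single K =>
    refine ⟨fun _ => 0, id, K, by simp, ⟨1, by simp⟩, by simp, by simp, ?_⟩
    intro M hM h
    exact absurd (List.mem_singleton.1 hM) h
  | @cons J M L _ hJ hM hML ih =>
    obtain ⟨rank, par, root, hroot, ⟨b, hb⟩, hinj, hmin, hpar⟩ := ih
    have hne : ∀ N ∈ L, N ≠ M := fun N hN h => hML (h ▸ hN)
    have hr : ∀ N ∈ L, Function.update rank M b N = rank N := fun N hN =>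
      Function.update_of_ne (hne N hN) _ _
    have hp : ∀ N ∈ L, Function.update par M J N = par N := fun N hN =>
      Function.update_of_ne (hne N hN) _ _
    refine ⟨Function.update rank M b, Function.update par M J, root, List.mem_cons_of_mem _ hroot,
      ⟨b + 1, ?_⟩, ?_, ?_, ?_⟩
    · rintro N hN
      rcases List.mem_cons.1 hN with rfl | hN
      · simp
      · rw [hr N hN]; exact (hb N hN).trans (Nat.lt_succ_self b)
    · rintro N hN N' hN' h
      rcases List.mem_cons.1 hN with rfl | hN₁ <;> rcases List.mem_cons.1 hN' with rfl | hN₂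
      · rfl
      · rw [hr N' hN₂, Function.update_self] at h
        exact absurd h (hb N' hN₂).ne'
      · rw [hr N hN₁, Function.update_self] at h
        exact absurd h (hb N hN₁).ne
      · rw [hr N hN₁, hr N' hN₂] at h
        exact hinj N hN₁ N' hN₂ h
    · rintro N hN
      rw [hr root hroot]
      rcases List.mem_cons.1 hN with rfl | hN
      · rw [Function.update_self]; exact (hb root hroot).le
      · rw [hr N hN]; exact hmin N hN
    · rintro N hN hNr
      rcases List.mem_cons.1 hN with rfl | hN
      · simp only [Function.update_self]
        refine ⟨List.mem_cons_of_mem _ hJ, by rw [hr J hJ]; exact hb J hJ, ?_⟩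
        rintro N' hN' h
        rcases List.mem_cons.1 hN' with rfl | hN'
        · rw [Function.update_self] at h
          exact absurd h (lt_irrefl b)
        · exact hM N' hN'
      · obtain ⟨h1, h2, h3⟩ := hpar N hN hNr
        rw [hp N hN, hr N hN]
        refine ⟨List.mem_cons_of_mem _ h1, by rw [hr _ h1]; exact h2, ?_⟩
        have hbN := hb N hN
        rintro N' hN' h
        rcases List.mem_cons.1 hN' with rfl | hN₁
        · rw [Function.update_self] at h
          exact absurd hbN (not_lt.2 h.le)
        · rw [hr N' hN₁] at h
          exact h3 N' hN₁ h

end RunningIntersection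

-- Trees from parent maps

section ParentGraph

variable {α : Type*}

/-- The graph on `α` in which each node except `root` is joined with its parent. -/
def parentGraph (par : α → α) (root : α) (hpar : ∀ x, x ≠ root → par x ≠ x) : SimpleGraph α where
  Adj x y := (x ≠ root ∧ par x = y) ∨ (y ≠ root ∧ par y = x)
  symm := ⟨fun _ _ h => h.symm⟩
  loopless := ⟨fun x h => h.elim (fun h => hpar x h.1 h.2) (fun h => hpar x h.1 h.2)⟩

/-- Following parents lowers the rank until the root, so the graph is connected; each non-root node
contributes at most one edge, so there are too few edges for a cycle. -/
theorem isTree_parentGraph [Finite α] {par : α → α} {root : α} (rank : α → ℕ)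
    (hrank : ∀ x, x ≠ root → rank (par x) < rank x) (hpar : ∀ x, x ≠ root → par x ≠ x) :
    (parentGraph par root hpar).IsTree := by
  classical
  have hconn : (parentGraph par root hpar).Connected := by
    have key : ∀ n x, rank x = n → (parentGraph par root hpar).Reachable x root := by
      intro n
      induction n using Nat.strong_induction_on with
      | _ n ih =>
        intro x hx
        by_cases h : x = root
        · rw [h]
        · have hadj : (parentGraph par root hpar).Adj x (par x) := Or.inl ⟨h, rfl⟩
          exact hadj.reachable.trans (ih _ (hx ▸ hrank x h) _ rfl)
    have : Nonempty α := ⟨root⟩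
    exact ⟨fun x y => (key _ x rfl).trans (key _ y rfl).symm⟩
  refine SimpleGraph.isTree_iff_connected_and_card.2 ⟨hconn, ?_⟩
  refine le_antisymm ?_ hconn.card_vert_le_card_edgeSet_add_one
  have hsub : (parentGraph par root hpar).edgeSet ⊆
      (fun x => s(x, par x)) '' {x | x ≠ root} := by
    intro e he
    induction e using Sym2.ind with
    | _ x y =>
      rcases he with ⟨h, h'⟩ | ⟨h, h'⟩
      · exact ⟨x, h, congrArg (fun z => s(x, z)) h'⟩
      · exact ⟨y, h, (congrArg (fun z => s(y, z)) h').trans Sym2.eq_swap⟩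
  have h1 : Nat.card (parentGraph par root hpar).edgeSet ≤ {x : α | x ≠ root}.ncard := by
    rw [Nat.card_coe_set_eq]
    exact (Set.ncard_le_ncard hsub (Set.toFinite _)).trans (Set.ncard_image_le (Set.toFinite _))
  have h2 : {x : α | x ≠ root}.ncard + 1 = Nat.card α := by
    have h3 : {x : α | x ≠ root} = {root}ᶜ := rfl
    rw [h3, ← Set.ncard_add_ncard_compl {root}, Set.ncard_singleton, add_comm]
  omega

end ParentGraph

-- Existence of clique trees for chordal graphs

section CliqueTrees

variable {V : Type*} {G : SimpleGraph V}

theorem exists_maxClique_superset [Finite V] {H : G.Subgraph} {Q : Set V} (hQ : Q ⊆ H.verts)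
    (hQc : Q.Pairwise H.Adj) : ∃ M ∈ maxCliques H, Q ⊆ M := by
  obtain ⟨M, hM, hmax⟩ := Set.Finite.exists_le_maximal
    (Set.toFinite {C : Set V | C ⊆ H.verts ∧ C.Pairwise H.Adj}) ⟨hQ, hQc⟩
  exact ⟨M, hmax, hM⟩

/-- Greedy growth of `L`, by induction on the number of uncovered vertices. Two invariants: the
covered boundary of a connected uncovered set lies in one listed clique, and so does every clique of
covered vertices. When nothing is uncovered, the second puts every maximal clique in `L`. -/
theorem exists_runningIntersection_append [Finite V] {H : G.Subgraph}
    (hΓ : IsChordalGraph H.spanningCoe) (n : ℕ) : ∀ L : List (Set V), RunningIntersection L →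
      (∀ K ∈ L, K ∈ maxCliques H) →
      (∀ D ⊆ {v ∈ H.verts | ∀ K ∈ L, v ∉ K}, ConnSet H.spanningCoe D →
        ∃ K ∈ L, ∀ N ∈ L, nb H.spanningCoe D ∩ N ⊆ K) →
      (∀ Q : Set V, Q.Pairwise H.Adj → (∀ v ∈ Q, ∃ K ∈ L, v ∈ K) → ∃ K ∈ L, Q ⊆ K) →
      {v ∈ H.verts | ∀ K ∈ L, v ∉ K}.ncard ≤ n →
      ∃ L' : List (Set V), RunningIntersection L' ∧ ∀ K, K ∈ L' ↔ K ∈ maxCliques H := by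
  induction n with
  | zero =>
    intro L hL hLmax _ hcl hn
    rw [Nat.le_zero, Set.ncard_eq_zero (Set.toFinite _)] at hn
    refine ⟨L, hL, fun K => ⟨hLmax K, fun hK => ?_⟩⟩
    obtain ⟨M, hM, hKM⟩ := hcl K hK.1.2 (fun v hv => by
      by_contra! hcon
      exact (hn ▸ (⟨hK.1.1 hv, hcon⟩ : v ∈ {v ∈ H.verts | ∀ K ∈ L, v ∉ K}) : v ∈ (∅ : Set V)))
    rwa [hKM.antisymm (hK.2 (hLmax M hM).1 hKM)]
  | succ n ih =>
    intro L hL hLmax hJ hcl hn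
    rcases Set.eq_empty_or_nonempty {v ∈ H.verts | ∀ K ∈ L, v ∉ K} with h0 | ⟨v₀, hv₀⟩
    · exact ih L hL hLmax hJ hcl (by rw [h0]; simp)
    set W := {v ∈ H.verts | ∀ K ∈ L, v ∉ K} with hW
    have hDW := compIn_subset (Γ := H.spanningCoe) hv₀
    have hD := connSet_compIn (Γ := H.spanningCoe) hv₀
    set D := compIn H.spanningCoe W v₀ with hDdef
    obtain ⟨J, hJL, hJ'⟩ := hJ D hDW hD
    have hnbD : ∀ b ∈ nb H.spanningCoe D, ∃ N ∈ L, b ∈ N := by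
      intro b hb
      by_contra! hcon
      obtain ⟨-, d, -, hdb⟩ := id hb
      exact not_mem_of_mem_nb_compIn hv₀ hb ⟨H.edge_vert (H.symm.symm _ _ hdb), hcon⟩
    have hBJ : nb H.spanningCoe D ⊆ J := fun b hb => by
      obtain ⟨N, hN, hbN⟩ := hnbD b hb
      exact hJ' N hN ⟨hb, hbN⟩
    have hB : (nb H.spanningCoe D).Pairwise H.Adj := (hLmax J hJL).1.2.mono hBJ
    obtain ⟨v, hvD, hv⟩ := exists_mem_commonNb hΓ hD ⟨v₀, mem_compIn_self⟩ hB (fun b hb => hb)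
    -- The new clique contains `v` and the whole boundary of `D`. Since v ∈ D, its members outside
    -- `D` are boundary vertices, so it meets old cliques only inside `J`.
    obtain ⟨M, hM, hQM⟩ := exists_maxClique_superset (H := H)
      (Q := insert v (nb H.spanningCoe D))
      (Set.insert_subset (hDW hvD).1 (hBJ.trans (hLmax J hJL).1.1)) (by
        rintro a (rfl | ha) b (rfl | hb) hab
        · exact absurd rfl hab
        · exact (hv b hb).symm
        · exact hv a ha
        · exact hB ha hb hab)
    have hvM : v ∈ M := hQM (Set.mem_insert _ _)
    have hBM : nb H.spanningCoe D ⊆ M := (Set.subset_insert _ _).trans hQM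
    have hMD : ∀ z ∈ M, z ∉ D → z ∈ nb H.spanningCoe D := by
      intro z hz hzD
      exact ⟨hzD, v, hvD, hM.1.2 hvM hz (fun h => hzD (h ▸ hvD))⟩
    have hML : M ∉ L := fun h => (hDW hvD).2 M h hvM
    have hMN : ∀ N ∈ L, M ∩ N ⊆ nb H.spanningCoe D := fun N hN z hz =>
      hMD z hz.1 fun hzD => (hDW hzD).2 N hN hz.2
    refine ih (M :: L) (.cons hL hJL (fun N hN => (hMN N hN).trans hBJ) hML) ?_ ?_ ?_ ?_
    · intro K hK
      rcases List.mem_cons.1 hK with rfl | hK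
      exacts [hM, hLmax K hK]
    · intro E hE hEc
      have hEW : E ⊆ W := fun e he => ⟨(hE he).1, fun K hK => (hE he).2 K (List.mem_cons_of_mem _ hK)⟩
      by_cases hmeet : ∃ z ∈ nb H.spanningCoe E, z ∈ D
      · obtain ⟨z, ⟨-, e, he, hez⟩, hzD⟩ := hmeet
        have hED : E ⊆ D := hEc.subset_compIn hEW he
          (mem_compIn_of_adj hv₀ hzD (hEW he) hez.symm)
        refine ⟨M, List.mem_cons_self, fun N hN => ?_⟩
        rcases List.mem_cons.1 hN with rfl | hN
        · exact Set.inter_subset_right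
        · rintro b ⟨⟨-, e', he', heb⟩, hbN⟩
          exact hBM ⟨fun hbD => (hDW hbD).2 N hN hbN, e', hED he', heb⟩
      · obtain ⟨K, hK, hK'⟩ := hJ E hEW hEc
        refine ⟨K, List.mem_cons_of_mem _ hK, fun N hN => ?_⟩
        rcases List.mem_cons.1 hN with rfl | hN
        · rintro b ⟨hb, hbM⟩
          obtain ⟨N, hN, hbN⟩ := hnbD b (hMD b hbM fun hbD => hmeet ⟨b, hb, hbD⟩)
          exact hK' N hN ⟨hb, hbN⟩
        · exact hK' N hN
    · intro Q hQc hQ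
      by_cases hQD : ∃ q ∈ Q, q ∈ D
      · obtain ⟨q, hqQ, hqD⟩ := hQD
        refine ⟨M, List.mem_cons_self, fun z hz => ?_⟩
        obtain ⟨N, hN, hzN⟩ := hQ z hz
        rcases List.mem_cons.1 hN with rfl | hN
        · exact hzN
        · have hzD : z ∉ D := fun hzD => (hDW hzD).2 N hN hzN
          exact hBM ⟨hzD, q, hqD, hQc hqQ hz (fun h => hzD (h ▸ hqD))⟩
      · obtain ⟨K, hK, hQK⟩ := hcl Q hQc fun z hz => by
          obtain ⟨N, hN, hzN⟩ := hQ z hz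
          rcases List.mem_cons.1 hN with rfl | hN
          · exact hnbD z (hMD z hzN fun hzD => hQD ⟨z, hz, hzD⟩)
          · exact ⟨N, hN, hzN⟩
        exact ⟨K, List.mem_cons_of_mem _ hK, hQK⟩
    · have hss : {v ∈ H.verts | ∀ K ∈ M :: L, v ∉ K} ⊂ W := by
        refine ⟨fun e he => ⟨he.1, fun K hK => he.2 K (List.mem_cons_of_mem _ hK)⟩, fun h => ?_⟩
        exact (h (hDW hvD)).2 M List.mem_cons_self hvM
      have := Set.ncard_lt_ncard hss (Set.toFinite _)
      omega

theorem exists_runningIntersection [Finite V] {H : G.Subgraph}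
    (hΓ : IsChordalGraph H.spanningCoe) :
    ∃ L : List (Set V), RunningIntersection L ∧ ∀ K, K ∈ L ↔ K ∈ maxCliques H := by
  obtain ⟨K, hK, -⟩ := exists_maxClique_superset (H := H) (Q := ∅) (by simp) (by simp)
  refine exists_runningIntersection_append hΓ _ [K] (.single K) (by simpa using hK) ?_ ?_ le_rfl
  · intro D _ _
    exact ⟨K, by simp, by simp⟩
  · intro Q _ hQ
    refine ⟨K, by simp, fun v hv => ?_⟩
    simpa using hQ v hv

/-- Every chordal graph has a rooted clique tree. -/
theorem nonempty_rootedCliqueTree [Finite V] {H : G.Subgraph}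
    (hΓ : IsChordalGraph H.spanningCoe) : Nonempty (RootedCliqueTree H) := by
  obtain ⟨L, hL, hLmem⟩ := exists_runningIntersection hΓ
  obtain ⟨rank, par, root, hroot, -, hinj, hmin, hpar⟩ := hL.exists_parent
  simp only [hLmem] at hroot hinj hmin hpar
  classical
  let r : maxCliques H := ⟨root, hroot⟩
  have hne : ∀ x : maxCliques H, x ≠ r → x.1 ≠ root := fun x hx h => hx (Subtype.ext h)
  let p : maxCliques H → maxCliques H := fun x =>
    if hx : x.1 ≠ root then ⟨par x.1, (hpar x.1 x.2 hx).1⟩ else x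
  have hp : ∀ x : maxCliques H, x.1 ≠ root → (p x).1 = par x.1 := by
    intro x hx
    simp only [p, dif_pos hx]
  have hrank : ∀ x : maxCliques H, x ≠ r → rank (p x).1 < rank x.1 := by
    intro x hx
    rw [hp x (hne x hx)]
    exact (hpar x.1 x.2 (hne x hx)).2.1
  have hpne : ∀ x : maxCliques H, x ≠ r → p x ≠ x := fun x hx h => by
    have := hrank x hx
    rw [h] at this
    exact lt_irrefl _ this
  refine ⟨⟨parentGraph p r hpne, isTree_parentGraph (fun x => rank x.1) hrank hpne, r, ?_⟩⟩
  intro v hv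
  obtain ⟨M, hM, hvM⟩ := exists_maxClique_superset (H := H) (Q := {v}) (by simpa using hv) (by simp)
  -- Any other clique containing `v` has larger rank than `m`, so running intersection with `m` puts
  -- `v` into its parent; climbing ends at `m`.
  obtain ⟨m, hm, hmmin⟩ := Set.exists_min_image {x : maxCliques H | v ∈ x.1} (fun x => rank x.1)
    (Set.toFinite _) ⟨⟨M, hM⟩, hvM rfl⟩
  have key : ∀ n, ∀ x : {x : maxCliques H | v ∈ x.1}, rank x.1.1 = n →
      ((parentGraph p r hpne).induce {x : maxCliques H | v ∈ x.1}).Reachable x ⟨m, hm⟩ := by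
    intro n
    induction n using Nat.strong_induction_on with
    | _ n ih =>
      rintro ⟨x, hx⟩ hn
      rcases (hmmin x hx).lt_or_eq with hlt | heq
      · have hxr : x ≠ r := by
          rintro rfl
          exact absurd (hmin m.1 m.2) (not_le.2 hlt)
        have hpx : v ∈ (p x).1 := by
          rw [hp x (hne x hxr)]
          exact (hpar x.1 x.2 (hne x hxr)).2.2 m.1 m.2 hlt ⟨hx, hm⟩
        have hadj : ((parentGraph p r hpne).induce {x : maxCliques H | v ∈ x.1}).Adj
            ⟨x, hx⟩ ⟨p x, hpx⟩ := Or.inl ⟨hxr, rfl⟩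
        exact hadj.reachable.trans (ih _ (hn ▸ hrank x hxr) ⟨p x, hpx⟩ rfl)
      · have : m = x := Subtype.ext (hinj _ m.2 _ x.2 heq)
        subst this
        exact .refl _
  have : Nonempty {x : maxCliques H | v ∈ x.1} := ⟨⟨m, hm⟩⟩
  exact ⟨fun x y => (key _ x rfl).trans (key _ y rfl).symm⟩

end CliqueTrees

-- Parents and subtrees in rooted trees

section Trees

variable {α : Type*} {T : SimpleGraph α}

theorem exists_adj_dist_succ (hT : T.Connected) {r x : α} (hx : x ≠ r) :
    ∃ y, T.Adj x y ∧ T.dist r x = T.dist r y + 1 := by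
  obtain ⟨p, hp⟩ := hT.exists_walk_length_eq_dist x r
  cases p with
  | nil => exact absurd rfl hx
  | @cons _ y _ h q =>
    refine ⟨y, h, ?_⟩
    have h1 := SimpleGraph.dist_le q
    have h2 := hT.dist_triangle (u := x) (v := y) (w := r)
    rw [SimpleGraph.dist_eq_one_iff_adj.2 h] at h2
    rw [SimpleGraph.Walk.length_cons] at hp
    rw [T.dist_comm (u := r), T.dist_comm (u := r)]
    omega

theorem eq_of_adj_dist_succ (hT : T.IsTree) {r x y z : α} (hy : T.Adj x y)
    (hyd : T.dist r x = T.dist r y + 1) (hz : T.Adj x z) (hzd : T.dist r x = T.dist r z + 1) :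
    y = z := by
  obtain ⟨p, hp⟩ := hT.connected.exists_walk_length_eq_dist r y
  obtain ⟨q, hq⟩ := hT.connected.exists_walk_length_eq_dist r z
  have hp' := (p.concat hy.symm).isPath_of_length_eq_dist (by
    rw [SimpleGraph.Walk.length_concat, hp, hyd])
  have hq' := (q.concat hz.symm).isPath_of_length_eq_dist (by
    rw [SimpleGraph.Walk.length_concat, hq, hzd])
  exact (SimpleGraph.Walk.concat_inj ((hT.existsUnique_path r x).unique hp' hq')).1

/-- A subtree which contains `x` and another node that is not farther away from the root also
contains the parent of `x`. -/
theorem mem_of_connected_induce (hT : T.IsTree) {A : Set α} (hA : (T.induce A).Connected)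
    {r x y t : α} (hx : x ∈ A) (ht : t ∈ A) (hxt : x ≠ t) (hd : T.dist r t ≤ T.dist r x)
    (hy : T.Adj x y) (hyd : T.dist r x = T.dist r y + 1) : y ∈ A := by
  by_contra hyA
  have hreach := hA.preconnected ⟨x, hx⟩ ⟨t, ht⟩
  rw [SimpleGraph.reachable_iff_reflTransGen] at hreach
  -- A walk in `A` from `x` can never rise above `x`: without the parent `y`, every upward step
  -- undoes a downward one. So every node reached is `x` or strictly deeper, which excludes `t`.
  have key : ∀ z : A, Relation.ReflTransGen (T.induce A).Adj ⟨x, hx⟩ z →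
      Relation.ReflTransGen (fun a b => T.Adj a b ∧ T.dist r b = T.dist r a + 1) x z.1 := by
    intro z hz
    induction hz with
    | refl => exact .refl
    | @tail b c _ hbc ih =>
      have hbc' : T.Adj b.1 c.1 := hbc
      rcases hT.dist_eq_dist_add_one_of_adj r hbc' with h | h
      · cases ih with
        | refl => exact absurd (eq_of_adj_dist_succ hT hy hyd hbc' h ▸ c.2) hyA
        | @tail w _ hw hwb =>
          rwa [← eq_of_adj_dist_succ hT hwb.1.symm hwb.2 hbc' h]
      · exact ih.tail ⟨hbc', h⟩
  have hle : ∀ z, Relation.ReflTransGen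
      (fun a b => T.Adj a b ∧ T.dist r b = T.dist r a + 1) x z →
      z = x ∨ T.dist r x < T.dist r z := by
    intro z hz
    induction hz with
    | refl => exact Or.inl rfl
    | tail _ h ih =>
      rcases ih with rfl | ih
      · right; omega
      · right; omega
  rcases hle t (key _ hreach) with h | h
  · exact hxt h.symm
  · omega

end Trees

-- Counting petals along a clique tree

section Petals

variable {V : Type*} {G : SimpleGraph V}

/-- M \ S is a clique of common neighbours of `S`, hence lies in one component. A petal is thus
recovered from `S` and `M` alone, with no choice of a vertex. -/
theorem compIn_eq_of_mem_clique {S M : Set V} (hM : M.Pairwise G.Adj) (hSM : S ⊆ M) {v y : V}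
    (hv : v ∈ commonNb G S) (hyM : y ∈ M) (hy : y ∈ compIn G (commonNb G S) v) :
    compIn G (commonNb G S) v = {z | ∃ u ∈ M \ S, z ∈ compIn G (commonNb G S) u} := by
  have hyS := compIn_subset hv hy
  ext z
  constructor
  · intro hz
    exact ⟨y, ⟨hyM, fun h => (hyS y h).ne rfl⟩, by rwa [compIn_eq_of_mem hy]⟩
  · rintro ⟨u, ⟨huM, huS⟩, hz⟩
    have hu : u ∈ compIn G (commonNb G S) v := by
      by_cases huy : u = y
      · rwa [huy]
      · refine mem_compIn_of_adj hv hy (fun s hs => ?_) (hM hyM huM (Ne.symm huy))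
        exact hM (hSM hs) huM (fun h => huS (h ▸ hs))
    rwa [← compIn_eq_of_mem hu]

/-- A component of the common neighbourhood of `S` which does not meet a maximal clique
`t ⊇ S` nearest to the root meets a maximal clique whose intersection with its parent is `S`. -/
theorem exists_label_eq [Finite V] (T : RootedCliqueTree (⊤ : G.Subgraph))
    {par : maxCliques (⊤ : G.Subgraph) → maxCliques (⊤ : G.Subgraph)}
    (hpar : ∀ x, x ≠ T.root → T.tree.Adj x (par x) ∧
      T.tree.dist T.root x = T.tree.dist T.root (par x) + 1)
    {S : Set V} (hSc : S.Pairwise G.Adj) {t : maxCliques (⊤ : G.Subgraph)} (ht : S ⊆ t.1)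
    (hmin : ∀ x : maxCliques (⊤ : G.Subgraph), S ⊆ x.1 →
      T.tree.dist T.root t ≤ T.tree.dist T.root x) {v : V} (hv : v ∈ commonNb G S)
    (htv : ∀ y ∈ t.1, y ∉ compIn G (commonNb G S) v) :
    ∃ x, x ≠ T.root ∧ x.1 ∩ (par x).1 = S ∧ ∃ y ∈ x.1, y ∈ compIn G (commonNb G S) v := by
  obtain ⟨M, hM, hvM⟩ := exists_maxClique_superset (H := (⊤ : G.Subgraph)) (Q := insert v S)
    (Set.subset_univ _) (by
      rintro a (rfl | ha) b (rfl | hb) hab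
      · exact absurd rfl hab
      · exact (hv b hb).symm
      · exact hv a ha
      · exact hSc ha hb hab)
  obtain ⟨x, ⟨hSx, y, hyx, hy⟩, hxmin⟩ := Set.exists_min_image
    {x : maxCliques (⊤ : G.Subgraph) | S ⊆ x.1 ∧ ∃ y ∈ x.1, y ∈ compIn G (commonNb G S) v}
    (fun x => T.tree.dist T.root x) (Set.toFinite _)
    ⟨⟨M, hM⟩, (Set.subset_insert _ _).trans hvM, v, hvM (Set.mem_insert _ _), mem_compIn_self⟩
  have hxt : x ≠ t := by rintro rfl; exact htv y hyx hy
  -- If `x` were the root, then `t`, being no farther away, would be the root too.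
  have hxr : x ≠ T.root := by
    rintro rfl
    have h := hmin _ hSx
    rw [SimpleGraph.dist_self, Nat.le_zero, T.isTree.connected.dist_eq_zero_iff] at h
    exact hxt h
  obtain ⟨hadj, hd⟩ := hpar x hxr
  have hSp : S ⊆ (par x).1 := fun s hs =>
    mem_of_connected_induce T.isTree (T.connected s (Set.mem_univ s))
      (A := {K : maxCliques (⊤ : G.Subgraph) | s ∈ K.1}) (hSx hs) (ht hs) hxt (hmin x hSx) hadj hd
  refine ⟨x, hxr, (Set.subset_inter hSx hSp).antisymm' ?_, y, hyx, hy⟩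
  rintro z ⟨hzx, hzp⟩
  by_contra hzS
  have hz : z ∈ compIn G (commonNb G S) v := by
    by_cases hzy : z = y
    · rwa [hzy]
    · refine mem_compIn_of_adj hv hy (fun s hs => ?_) (x.2.1.2 hyx hzx (Ne.symm hzy))
      exact x.2.1.2 (hSx hs) hzx (fun h => hzS (h ▸ hs))
  -- An extra vertex `z` of the intersection would belong to the component, so the parent would be a
  -- closer node meeting it.
  have := hxmin (par x) ⟨hSp, z, hzp, hz⟩
  omega

/-- A graph with `m` maximal cliques has at most `2 (m - 1)` petals. -/
theorem ncard_petals_le [Finite V] (T : RootedCliqueTree (⊤ : G.Subgraph)) :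
    {Y : Set V | IsPetal G Y}.ncard + 2 ≤ 2 * (maxCliques (⊤ : G.Subgraph)).ncard := by
  have hpar : ∀ x, ∃ y, x ≠ T.root → T.tree.Adj x y ∧
      T.tree.dist T.root x = T.tree.dist T.root y + 1 := by
    intro x
    by_cases h : x = T.root
    · exact ⟨x, fun h' => absurd h h'⟩
    · obtain ⟨y, hy⟩ := exists_adj_dist_succ T.isTree.connected h
      exact ⟨y, fun _ => hy⟩
  choose par hpar using hpar
  have htop : ∀ S : Set V, ∃ t : maxCliques (⊤ : G.Subgraph), S.Pairwise G.Adj → S ⊆ t.1 ∧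
      ∀ x : maxCliques (⊤ : G.Subgraph), S ⊆ x.1 →
        T.tree.dist T.root t ≤ T.tree.dist T.root x := by
    intro S
    by_cases hS : S.Pairwise G.Adj
    · obtain ⟨M, hM, hSM⟩ := exists_maxClique_superset (H := (⊤ : G.Subgraph)) (Q := S)
        (Set.subset_univ _) hS
      obtain ⟨t, ht, htmin⟩ := Set.exists_min_image
        {x : maxCliques (⊤ : G.Subgraph) | S ⊆ x.1}
        (fun x => T.tree.dist T.root x) (Set.toFinite _) ⟨⟨M, hM⟩, hSM⟩
      exact ⟨t, fun _ => ⟨ht, htmin⟩⟩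
    · exact ⟨T.root, fun h => absurd h hS⟩
  choose top htop using htop
  let lab : maxCliques (⊤ : G.Subgraph) → Set V := fun x => x.1 ∩ (par x).1
  let f : Set V → maxCliques (⊤ : G.Subgraph) → Set V := fun S x =>
    {z | ∃ u ∈ x.1 \ S, z ∈ compIn G (commonNb G S) u}
  have hsub : {Y : Set V | IsPetal G Y} ⊆
      ((fun x => f (lab x) x) '' {x | x ≠ T.root}) ∪
        ((fun x => f (lab x) (top (lab x))) '' {x | x ≠ T.root}) := by
    rintro Y ⟨S, -, hSc, v, hv, rfl, w, hw, hwv⟩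
    obtain ⟨hSt, hmin⟩ := htop S hSc
    -- If the petal meets the top clique of `S`, the component of `w` does not, and it is that
    -- component which shows that `S` is a label.
    by_cases h : ∃ y ∈ (top S).1, y ∈ compIn G (commonNb G S) v
    · obtain ⟨y, hyt, hy⟩ := h
      have htw : ∀ y' ∈ (top S).1, y' ∉ compIn G (commonNb G S) w := by
        intro y' hyt' hy'
        have hy'v : y' ∈ compIn G (commonNb G S) v := by
          rw [compIn_eq_of_mem_clique (top S).2.1.2 hSt hv hyt hy]
          exact ⟨y', ⟨hyt', fun h => (compIn_subset hw hy' y' h).ne rfl⟩, mem_compIn_self⟩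
        rw [← compIn_eq_of_mem hy'v, compIn_eq_of_mem hy'] at hwv
        exact hwv mem_compIn_self
      obtain ⟨x, hxr, hxS, -⟩ := exists_label_eq T hpar hSc hSt hmin hw htw
      refine Or.inr ⟨x, hxr, ?_⟩
      change f (lab x) (top (lab x)) = _
      rw [show lab x = S from hxS]
      exact (compIn_eq_of_mem_clique (top S).2.1.2 hSt hv hyt hy).symm
    · obtain ⟨x, hxr, hxS, y, hyx, hy⟩ := exists_label_eq T hpar hSc hSt hmin hv
        (fun y hy hy' => h ⟨y, hy, hy'⟩)
      refine Or.inl ⟨x, hxr, ?_⟩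
      change f (lab x) x = _
      rw [show lab x = S from hxS]
      exact (compIn_eq_of_mem_clique x.2.1.2 (hxS ▸ Set.inter_subset_left) hv hyx hy).symm
  have h1 := Set.ncard_le_ncard hsub (Set.toFinite _)
  have h2 := Set.ncard_union_le ((fun x => f (lab x) x) '' {x | x ≠ T.root})
    ((fun x => f (lab x) (top (lab x))) '' {x | x ≠ T.root})
  have h3 := Set.ncard_image_le (f := fun x => f (lab x) x) (Set.toFinite {x | x ≠ T.root})
  have h4 := Set.ncard_image_le (f := fun x => f (lab x) (top (lab x)))
    (Set.toFinite {x | x ≠ T.root})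
  have h5 : {x | x ≠ T.root}.ncard + 1 = (maxCliques (⊤ : G.Subgraph)).ncard := by
    have : {x | x ≠ T.root} = {T.root}ᶜ := rfl
    rw [this, ← Nat.card_coe_set_eq (maxCliques _), ← Set.ncard_add_ncard_compl {T.root},
      Set.ncard_singleton, add_comm]
  omega

end Petals

-- Graphs visited by an execution, and termination

section Executions

variable {V : Type*} {G : SimpleGraph V}

theorem CountRun.isExplorable [Finite V] (hG : IsUCCG G) {memo memo' : Memo G} {H : G.Subgraph}
    {calls : List G.Subgraph} {n : ℕ} (h : CountRun memo H calls n memo') (hH : IsExplorable H) :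
    ∀ C ∈ calls, IsExplorable C := by
  revert hH
  refine CountRun.rec
    (motive_1 := fun _ H calls _ _ _ => IsExplorable H → ∀ C ∈ calls, IsExplorable C)
    (motive_2 := fun H _ _ _ _ calls _ _ _ => IsExplorable H → ∀ C ∈ calls, IsExplorable C)
    (motive_3 := fun _ comps _ calls _ _ _ => (∀ C ∈ comps, IsExplorable C) →
      ∀ C ∈ calls, IsExplorable C) ?_ ?_ ?_ ?_ ?_ ?_ h
  · intro _ _ _ _ hH C hC
    rwa [List.mem_singleton.1 hC]
  · intro _ _ _ _ _ _ _ _ ih hH C hC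
    rcases List.mem_cons.1 hC with rfl | hC
    · exact hH
    · exact ih hH C hC
  · intro _ _ _ _ _ C hC
    simp at hC
  · intro H T _ _ _ x _ _ comps _ _ _ _ _ _ hcomps _ _ ih₁ ih₂ hH C hC
    rcases List.mem_append.1 hC with hC | hC
    · exact ih₁ (fun C hC => hH.of_mem_components hG x.2 ((hcomps.2 C).1 hC)) C hC
    · exact ih₂ hH C hC
  · intro _ _ _ C hC
    simp at hC
  · intro _ _ _ _ _ _ _ _ _ _ _ _ ih₁ ih₂ hcomps C hC
    rcases List.mem_append.1 hC with hC | hC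
    · exact ih₁ (hcomps _ List.mem_cons_self) C hC
    · exact ih₂ (fun C hC => hcomps C (List.mem_cons_of_mem _ hC)) C hC

theorem exists_prodRun (comps : List G.Subgraph)
    (h : ∀ C ∈ comps, ∀ memo : Memo G, ∃ calls n memo', CountRun memo C calls n memo') :
    ∀ (memo : Memo G) (prod : ℕ), ∃ calls prod' memo', ProdRun memo comps prod calls prod' memo' := by
  induction comps with
  | nil => exact fun memo prod => ⟨_, _, _, .nil⟩
  | cons C comps ih =>
    intro memo prod
    obtain ⟨_, n, memo₁, h₁⟩ := h C List.mem_cons_self memo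
    obtain ⟨_, _, _, h₂⟩ := ih (fun C hC => h C (List.mem_cons_of_mem _ hC)) memo₁ (prod * n)
    exact ⟨_, _, _, .cons h₁ h₂⟩

theorem exists_queueRun [Finite V] {H : G.Subgraph} (T : RootedCliqueTree H)
    (h : ∀ x : maxCliques H, ∀ C ∈ components H x.1, ∀ memo : Memo G,
      ∃ calls n memo', CountRun memo C calls n memo') (memo : Memo G) (Q : List (maxCliques H))
    (sum : ℕ) : ∃ calls sum' memo', QueueRun H T memo Q sum calls sum' memo' := by
  obtain ⟨N, hN⟩ := (Set.finite_range fun x => T.tree.dist T.root x).bddAbove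
  have hN' : ∀ x, T.tree.dist T.root x ≤ N := fun x => hN ⟨x, rfl⟩
  let m := Nat.card (maxCliques H)
  -- With base m + 1, a node outweighs its at most m children together, so each pop lowers the total
  -- weight of the queue.
  let wt : maxCliques H → ℕ := fun x => (m + 1) ^ (N - T.tree.dist T.root x)
  have hch : ∀ (x : maxCliques H) (ch : List (maxCliques H)), IsOrderingOf (T.children x) ch →
      (ch.map wt).sum < wt x := by
    intro x ch hch
    have hlen : ch.length ≤ m := by
      have := Fintype.ofFinite (maxCliques H)
      exact hch.1.length_le_card.trans_eq (Nat.card_eq_fintype_card).symm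
    rcases ch with _ | ⟨y, ch⟩
    · simp [wt]
    · have hdist : ∀ z ∈ y :: ch, wt z = (m + 1) ^ (N - (T.tree.dist T.root x + 1)) := by
        intro z hz
        simp only [wt, ((hch.2 z).1 hz).2]
      have hy := hN' y
      rw [((hch.2 y).1 List.mem_cons_self).2] at hy
      rw [List.map_congr_left hdist, List.map_const', List.sum_replicate, smul_eq_mul]
      have : wt x = (m + 1) ^ (N - (T.tree.dist T.root x + 1)) * (m + 1) := by
        rw [← pow_succ]
        refine congrArg (fun k => (m + 1) ^ k) ?_
        omega
      rw [this, mul_comm]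
      exact Nat.mul_lt_mul_of_pos_left (Nat.lt_succ_of_le hlen) (Nat.pow_pos (Nat.succ_pos m))
  have key : ∀ (k : ℕ) (memo : Memo G) (Q : List (maxCliques H)) (sum : ℕ), (Q.map wt).sum ≤ k →
      ∃ calls sum' memo', QueueRun H T memo Q sum calls sum' memo' := by
    intro k
    induction k with
    | zero =>
      intro memo Q sum hk
      rcases Q with _ | ⟨x, Q⟩
      · exact ⟨_, _, _, .done⟩
      · have : 0 < wt x := Nat.pow_pos (Nat.succ_pos m)
        simp only [List.map_cons, List.sum_cons] at hk
        omega
    | succ k ih =>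
      intro memo Q sum hk
      rcases Q with _ | ⟨x, Q⟩
      · exact ⟨_, _, _, .done⟩
      · obtain ⟨ch, hch'⟩ := exists_isOrderingOf (T.children x)
        obtain ⟨comps, hcomps⟩ := exists_isOrderingOf (components H x.1)
        obtain ⟨_, prod, memo₁, h₁⟩ := exists_prodRun comps
          (fun C hC => h x C ((hcomps.2 C).1 hC)) memo 1
        obtain ⟨_, _, _, h₂⟩ := ih memo₁ (Q ++ ch)
          (sum + phi x.1 (T.forbiddenPrefixes x) * prod) (by
            have := hch x ch hch'
            simp only [List.map_append, List.sum_append, List.map_cons, List.sum_cons] at hk ⊢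
            omega)
        exact ⟨_, _, _, .pop hch' hcomps h₁ h₂⟩
  exact key _ memo Q sum le_rfl

/-- Induction on the number of vertices: a component avoids a nonempty maximal clique of `H`, so it
is strictly smaller. -/
theorem exists_countRun [Finite V] (hG : IsUCCG G) (n : ℕ) : ∀ (H : G.Subgraph), IsExplorable H →
    H.verts.ncard ≤ n → ∀ memo : Memo G, ∃ calls k memo', CountRun memo H calls k memo' := by
  induction n with
  | zero =>
    intro H hH hn
    rw [Nat.le_zero, Set.ncard_eq_zero (Set.toFinite _)] at hn
    exact absurd hn (hH.connected hG.1).nonempty.ne_empty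
  | succ n ih =>
    intro H hH hn memo
    cases hmemo : memo H with
    | some k => exact ⟨_, _, _, .hit hmemo⟩
    | none =>
      obtain ⟨T⟩ := nonempty_rootedCliqueTree (hH.isChordalGraph hG.2)
      obtain ⟨_, _, _, hrun⟩ := exists_queueRun T (fun x C hC => ih C
        (hH.of_mem_components hG x.2 hC) (by
          obtain ⟨v, hv⟩ := (hH.connected hG.1).nonempty
          obtain ⟨k, hk⟩ : x.1.Nonempty := by
            rw [Set.nonempty_iff_ne_empty]
            intro h0
            have := x.2.2 (y := {v}) ⟨by simpa using hv, by simp⟩ (by simp [h0]) rfl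
            simp [h0] at this
          have hss : C.verts ⊂ H.verts := ⟨fun z hz => (hC.1.1.1 hz).1,
            fun h => (hC.1.1.1 (h (x.2.1.1 hk))).2 hk⟩
          have := Set.ncard_lt_ncard hss (Set.toFinite _)
          omega)) memo [T.root] 0
      exact ⟨_, _, _, .miss hmemo T hrun⟩

end Executions

end CliquePicking

theorem mainTheorem10 {V : Type*} [Fintype V] (G : SimpleGraph V) (hG : IsUCCG G) :
    (∃ (calls : List G.Subgraph) (n : ℕ), CliquePicking.IsExecution G calls n) ∧
    ∀ (calls : List G.Subgraph) (n : ℕ), CliquePicking.IsExecution G calls n →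
      (∀ H ∈ calls, IsUCCG H.coe) ∧
      ({H : G.Subgraph | H ∈ calls}.ncard : ℤ) ≤
        2 * ((CliquePicking.maxCliques (⊤ : G.Subgraph)).ncard : ℤ) - 1 := by
  have htop : CliquePicking.IsExplorable (⊤ : G.Subgraph) := Or.inl rfl
  constructor
  · obtain ⟨calls, n, memo', h⟩ := CliquePicking.exists_countRun hG _ ⊤ htop le_rfl (fun _ => none)
    exact ⟨calls, n, memo', h⟩
  · rintro calls n ⟨memo', h⟩
    have hcalls := h.isExplorable hG htop
    refine ⟨fun H hH => (hcalls H hH).isUCCG hG, ?_⟩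
    obtain ⟨T⟩ := CliquePicking.nonempty_rootedCliqueTree (htop.isChordalGraph hG.2)
    have hsub : {H : G.Subgraph | H ∈ calls} ⊆ insert ⊤
        ((fun Y => (⊤ : G.Subgraph).induce Y) '' {Y | CliquePicking.IsPetal G Y}) := by
      intro H hH
      rcases hcalls H hH with rfl | ⟨Y, hY, rfl⟩
      · exact Set.mem_insert _ _
      · exact Set.mem_insert_of_mem _ ⟨Y, hY, rfl⟩
    have h1 := Set.ncard_le_ncard hsub ((Set.toFinite _).insert _)
    have h2 := Set.ncard_insert_le (⊤ : G.Subgraph)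
      ((fun Y => (⊤ : G.Subgraph).induce Y) '' {Y | CliquePicking.IsPetal G Y})
    have h3 := Set.ncard_image_le (f := fun Y => (⊤ : G.Subgraph).induce Y)
      (Set.toFinite {Y | CliquePicking.IsPetal G Y})
    have h4 := CliquePicking.ncard_petals_le T
    omega
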